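/- Write $e(x)=\exp(2\pi i x)$ and $\Gamma=\mathrm{SL}_2(\mathbb Z)$. Let $k\in\mathbb Z$, let $L\in\mathrm{Mat}_N(\mathbb Z)$ be symmetric with even diagonal entries, and put $L[x]=x^{\mathrm{tr}}Lx$ for vectors or matrices $x$ of compatible size. A Jacobi form of weight $k$ and index $L$ is a holomorphic function $\phi:\mathbb H\times\mathbb C^N\to\mathbb C$ such that for all $\gamma=\left(\begin{smallmatrix}a&b\\c&d\end{smallmatrix}\right)\in\Gamma$ and $\lambda,\mu\in\mathbb Z^N$ $$\phi(\tau,z)=(c\tau+d)^{-k}\,e\Big(-\frac{c\,L[z+\lambda\tau+\mu]}{2(c\tau+d)}+\frac{\tau L[\lambda]}{2}+\lambda^{\mathrm{tr}}Lz\Big)\,\phi\Big(\frac{a\tau+b}{c\tau+d},\frac{z+\lambda\tau+\mu}{c\tau+d}\Big),$$ and such that $e(\tau L[\alpha]/2)\,\phi(\tau,\alpha\tau+\beta)=O(1)$ as $\operatorname{Im}\tau\to\infty$ for all $\alpha,\beta\in\mathbb Q^N$. Let $J_{k,L}$ be the space of these forms, and $M_\kappa$ the space of elliptic modular forms of weight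 $\kappa$ for $\Gamma$. For $s\in\mathrm{Mat}_{N,N'}(\mathbb Z)$ put $\phi[s](\tau,z)=\phi(\tau,sz)$. For an integer $l>0$ put $$(\phi|_{k,L}V_l)(\tau,z)=l^{k-1}\sum_{\gamma\in\Gamma\backslash\{\gamma\in\mathrm{Mat}_2(\mathbb Z):\det\gamma=l\}}(c\tau+d)^{-k}\,e\Big(-\frac{c\,l\,L[z]}{2(c\tau+d)}\Big)\,\phi\Big(\gamma\tau,\frac{lz}{c\tau+d}\Big),$$ $$(f|T_l)(\tau)=l^{\kappa-1}\sum_{\gamma\in\Gamma\backslash\{\gamma\in\mathrm{Mat}_2(\mathbb Z):\det\gamma=l\}}(c\tau+d)^{-\kappa}f(\gamma\tau)\qquad(f\in M_\kappa).$$ For a Jacobi form $\phi$ of weight $k$ and rank one index $(2m)$ and $\nu\ge0$ put $$\mathcal D_{2\nu}(\phi)=\sum_{0\le\mu\le\nu}\frac{(-1)^\mu(2\nu)!\,(k+2\nu-\mu-2)!}{\mu!\,(2\nu-2\mu)!\,(k+\nu-2)!}\Big(\frac{\partial_z}{2\pi i}\Big)^{2\nu-2\mu}\Big(\frac{m\,\partial_\tau}{2\pi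 i}\Big)^{\mu}\phi\,\Big|_{z=0}\quad\text{if $k$ is even},$$ $$\mathcal D_{2\nu+1}(\phi)=\sum_{0\le\mu\le\nu}\frac{(-1)^\mu(2\nu+1)!\,(k+2\nu-\mu-1)!}{\mu!\,(2\nu+1-2\mu)!\,(k+\nu-1)!}\Big(\frac{\partial_z}{2\pi i}\Big)^{2\nu+1-2\mu}\Big(\frac{m\,\partial_\tau}{2\pi i}\Big)^{\mu}\phi\,\Big|_{z=0}\quad\text{if $k$ is odd},$$ and $\mathcal D_\nu(\phi)=0$ if $k$ and $\nu$ have different parity; a quotient of factorials $(x+j)!/x!$ with $j\ge0$ is read as $(x+1)\cdots(x+j)$. Then the summands of $\phi|_{k,L}V_l$ (if $\phi|_{k,L}\gamma=\phi$ for all $\gamma\in\Gamma$) and of $f|T_l$ do not depend on the choice of representatives, and the following holds. (1) For all $s\in\mathrm{Mat}_{N,N'}(\mathbb Z)$ and all $\phi:\mathbb H\times\mathbb C^N\to\mathbb C$ (for a fixed choice of representatives, if $\phi$ is not $\Gamma$-invariant), $$\phi[s]\big|_{k,L[s]}V_l=\big(\phi\big|_{k,L}V_l\big)[s],$$ and $\phi[s]\in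 J_{k,L[s]}$ if $\phi\in J_{k,L}$. (2) $V_l$ maps $J_{k,L}$ to $J_{k,lL}$, and $T_l$ maps $M_\kappa$ to $M_\kappa$ for every $\kappa\in\mathbb Z$. For all $s\in\mathbb Z^N$, $\nu\ge0$ and $\phi\in J_{k,L}$, the functions $\mathcal D_\nu(\phi[s])$ and $\mathcal D_\nu\big((\phi|_{k,L}V_l)[s]\big)$ lie in $M_{k+\nu}$ (here $\phi[s]$ has index $L[s]$ and $(\phi|_{k,L}V_l)[s]$ has index $lL[s]$), and $$\mathcal D_\nu\big((\phi|_{k,L}V_l)[s]\big)=\mathcal D_\nu(\phi[s])\,\big|\,T_l.$$ -/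

import Mathlib

open UpperHalfPlane Matrix
open scoped MatrixGroups ModularForm

noncomputable section

namespace JacobiHecke

/-- `e(x) = exp(2πi x)`. -/
def e (x : ℂ) : ℂ := Complex.exp (2 * Real.pi * Complex.I * x)

/-- A Jacobi index: a symmetric integral matrix with even diagonal entries. -/
structure IsJacobiIndex {N : ℕ} (L : Matrix (Fin N) (Fin N) ℤ) : Prop where
  symm : L.IsSymm
  even_diag : ∀ i, Even (L i i)

/-- The index `L[s] = sᵗ L s`. -/
def indexPullback {N N' : ℕ} (L : Matrix (Fin N) (Fin N) ℤ) (s : Matrix (Fin N) (Fin N') ℤ) :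
    Matrix (Fin N') (Fin N') ℤ :=
  sᵀ * L * s

/-- The bilinear form `zᵗ L w` on `ℂ^N`. -/
def bil {N : ℕ} (L : Matrix (Fin N) (Fin N) ℤ) (z w : Fin N → ℂ) : ℂ :=
  z ⬝ᵥ (L.map (Int.cast : ℤ → ℂ) *ᵥ w)

/-- The value `L[z] = zᵗ L z` for `z ∈ ℂ^N`. -/
def quad {N : ℕ} (L : Matrix (Fin N) (Fin N) ℤ) (z : Fin N → ℂ) : ℂ := bil L z z

/-- The factor `c τ + d` of an integral `2 × 2` matrix. -/
def autFactor (M : Matrix (Fin 2) (Fin 2) ℤ) (τ : ℍ) : ℂ := (M 1 0 : ℂ) * τ + (M 1 1 : ℂ)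

/-- The point `(a τ + b) / (c τ + d)`; it is only used for matrices of positive determinant, for
which the quotient has positive imaginary part, so that `ofComplex` is the identity on it. -/
def moebius (M : Matrix (Fin 2) (Fin 2) ℤ) (τ : ℍ) : ℍ :=
  ofComplex (((M 0 0 : ℂ) * τ + (M 0 1 : ℂ)) / autFactor M τ)

/-- The weight `k`, index `L` action of `(γ, (lam, mu)) ∈ SL₂(ℤ) ⋉ (ℤ^N × ℤ^N)` on functions
on `ℍ × ℂ^N`. -/
def jacobiSlash {N : ℕ} (k : ℤ) (L : Matrix (Fin N) (Fin N) ℤ) (γ : SL(2, ℤ))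
    (lam mu : Fin N → ℤ) (φ : ℍ → (Fin N → ℂ) → ℂ) (τ : ℍ) (z : Fin N → ℂ) : ℂ :=
  let lamC : Fin N → ℂ := fun i => (lam i : ℂ)
  let w : Fin N → ℂ := fun i => z i + (lam i : ℂ) * τ + (mu i : ℂ)
  autFactor γ.1 τ ^ (-k) *
    e (-((γ.1 1 0 : ℤ) : ℂ) * quad L w / (2 * autFactor γ.1 τ)
        + τ * quad L lamC / 2 + bil L lamC z) *
    φ (moebius γ.1 τ) (fun i => w i / autFactor γ.1 τ)

/-- Jacobi forms of weight `k` and index `L`: holomorphic functions on `ℍ × ℂ^N` that are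
invariant under the full Jacobi group, and such that `e(L[α] τ / 2) φ(τ, α τ + β)` stays bounded
as `Im τ → ∞` for all rational vectors `α`, `β`. -/
structure IsJacobiForm {N : ℕ} (k : ℤ) (L : Matrix (Fin N) (Fin N) ℤ)
    (φ : ℍ → (Fin N → ℂ) → ℂ) : Prop where
  holo : DifferentiableOn ℂ (fun p : ℂ × (Fin N → ℂ) => φ (ofComplex p.1) p.2)
    {p : ℂ × (Fin N → ℂ) | 0 < p.1.im}
  invariant : ∀ (γ : SL(2, ℤ)) (lam mu : Fin N → ℤ), jacobiSlash k L γ lam mu φ = φ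
  bounded : ∀ α β : Fin N → ℚ, IsBoundedAtImInfty (fun τ : ℍ =>
    e (τ * quad L (fun i => (α i : ℂ)) / 2) * φ τ (fun i => (α i : ℂ) * τ + (β i : ℂ)))

/-- The restriction `φ[s](τ, z) = φ(τ, s z)`. -/
def restrict {N N' : ℕ} (s : Matrix (Fin N) (Fin N') ℤ) (φ : ℍ → (Fin N → ℂ) → ℂ) :
    ℍ → (Fin N' → ℂ) → ℂ :=
  fun τ z => φ τ (s.map (Int.cast : ℤ → ℂ) *ᵥ z)

/-- The quotient `SL₂(ℤ) \ {M ∈ Mat₂(ℤ) : det M = l}`. -/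
abbrev HeckeCosets (l : ℕ) : Type :=
  MulAction.orbitRel.Quotient SL(2, ℤ) (FixedDetMatrix (Fin 2) ℤ (l : ℤ))

/-- The quotient is finite, so that the finite sums below are genuine. -/
theorem finite_heckeCosets (l : ℕ) (hl : 0 < l) : Finite (HeckeCosets l) := by
  have hl' : (l : ℤ) ≠ 0 := by exact_mod_cast hl.ne'
  let f : FixedDetMatrices.reps (l : ℤ) → HeckeCosets l := fun A => Quotient.mk _ A.1
  refine Finite.of_surjective f fun q => ?_
  induction q using Quotient.inductionOn with
  | h A =>
    have key : ∀ (g : SL(2, ℤ)) (B : FixedDetMatrix (Fin 2) ℤ (l : ℤ)),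
        (Quotient.mk _ (g • B) : HeckeCosets l) = Quotient.mk _ B := fun g B =>
      Quotient.sound ⟨g, rfl⟩
    refine FixedDetMatrices.induction_on (C := fun B => ∃ a, f a = Quotient.mk _ B) hl' ?_ ?_ ?_
    · intro B h1 h2 h3 h4
      exact ⟨⟨B, h1, h2, h3, h4⟩, rfl⟩
    · rintro B ⟨a, ha⟩
      exact ⟨a, ha.trans (key _ B).symm⟩
    · rintro B ⟨a, ha⟩
      exact ⟨a, ha.trans (key _ B).symm⟩

/-- The summand of `φ |_{k,L} V_l` that belongs to a matrix `M` of determinant `l`. -/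
def heckeVTerm {N : ℕ} (k : ℤ) (L : Matrix (Fin N) (Fin N) ℤ) (l : ℕ)
    (φ : ℍ → (Fin N → ℂ) → ℂ) (M : FixedDetMatrix (Fin 2) ℤ (l : ℤ)) (τ : ℍ) (z : Fin N → ℂ) :
    ℂ :=
  autFactor M.1 τ ^ (-k) *
    e (-((M.1 1 0 : ℤ) : ℂ) * ((l : ℂ) * quad L z) / (2 * autFactor M.1 τ)) *
    φ (moebius M.1 τ) (fun i => (l : ℂ) * z i / autFactor M.1 τ)

/-- The operator `V_l`: the sum over `SL₂(ℤ) \ {det = l}`, through representatives of the cosets,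
with the factor `l^(k-1)`. -/
def heckeV {N : ℕ} (k : ℤ) (L : Matrix (Fin N) (Fin N) ℤ) (l : ℕ)
    (φ : ℍ → (Fin N → ℂ) → ℂ) (τ : ℍ) (z : Fin N → ℂ) : ℂ :=
  (l : ℂ) ^ (k - 1) * ∑ᶠ q : HeckeCosets l, heckeVTerm k L l φ (Quotient.out q) τ z

/-- The summand of the classical Hecke operator `T_l` in weight `κ` that belongs to a matrix `M`
of determinant `l`. -/
def heckeTTerm (κ : ℤ) (l : ℕ) (f : ℍ → ℂ) (M : FixedDetMatrix (Fin 2) ℤ (l : ℤ)) (τ : ℍ) : ℂ :=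
  autFactor M.1 τ ^ (-κ) * f (moebius M.1 τ)

/-- The classical Hecke operator `T_l` on elliptic modular forms of weight `κ`. -/
def heckeT (κ : ℤ) (l : ℕ) (f : ℍ → ℂ) (τ : ℍ) : ℂ :=
  (l : ℂ) ^ (κ - 1) * ∑ᶠ q : HeckeCosets l, heckeTTerm κ l f (Quotient.out q) τ

/-- `(∂_z / 2πi)^a (∂_τ / 2πi)^b φ` at `z = 0`, for a function on `ℍ × ℂ`. -/
def taylorDeriv (a b : ℕ) (φ : ℍ → (Fin 1 → ℂ) → ℂ) (τ : ℍ) : ℂ :=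
  (2 * Real.pi * Complex.I)⁻¹ ^ (a + b) *
    iteratedDeriv a
      (fun z : ℂ => iteratedDeriv b (fun t : ℂ => φ (ofComplex t) (fun _ => z)) (τ : ℂ)) 0

/-- The quotient of factorials `(x + j)! / x!`, that is `(x + 1)(x + 2) ⋯ (x + j)`, for an
integer `x`. -/
def factorialQuotient (x : ℤ) (j : ℕ) : ℂ := ∏ i ∈ Finset.range j, ((x : ℂ) + 1 + (i : ℂ))

/-- The operator `𝒟_{2ν}` in weight `k` and scalar index `m`. The quotient of factorials is
`(k + 2ν - μ - 2)! / (k + ν - 2)!`. -/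
def taylorEven (k : ℤ) (m : ℂ) (ν : ℕ) (φ : ℍ → (Fin 1 → ℂ) → ℂ) (τ : ℍ) : ℂ :=
  ∑ μ ∈ Finset.range (ν + 1),
    (-1) ^ μ * ((2 * ν).factorial : ℂ) * factorialQuotient (k + ν - 2) (ν - μ) /
        ((μ.factorial : ℂ) * ((2 * ν - 2 * μ).factorial : ℂ)) *
      m ^ μ * taylorDeriv (2 * ν - 2 * μ) μ φ τ

/-- The operator `𝒟_{2ν+1}` in weight `k` and scalar index `m`. The quotient of factorials is
`(k + 2ν - μ - 1)! / (k + ν - 1)!`. -/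
def taylorOdd (k : ℤ) (m : ℂ) (ν : ℕ) (φ : ℍ → (Fin 1 → ℂ) → ℂ) (τ : ℍ) : ℂ :=
  ∑ μ ∈ Finset.range (ν + 1),
    (-1) ^ μ * ((2 * ν + 1).factorial : ℂ) * factorialQuotient (k + ν - 1) (ν - μ) /
        ((μ.factorial : ℂ) * ((2 * ν + 1 - 2 * μ).factorial : ℂ)) *
      m ^ μ * taylorDeriv (2 * ν + 1 - 2 * μ) μ φ τ

open Classical in
/-- The operator `𝒟_n` on Jacobi forms of weight `k` and rank one index `L`, which is the
scalar index `m = L / 2`; it is zero unless `k` and `n` have the same parity. -/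
def taylorOp (k : ℤ) (L : Matrix (Fin 1) (Fin 1) ℤ) (n : ℕ) (φ : ℍ → (Fin 1 → ℂ) → ℂ) :
    ℍ → ℂ :=
  if Even k ∧ Even n then taylorEven k ((L 0 0 : ℂ) / 2) (n / 2) φ
  else if Odd k ∧ Odd n then taylorOdd k ((L 0 0 : ℂ) / 2) (n / 2) φ
  else 0

end JacobiHecke

end

/-!
An integral matrix of determinant `l > 0` maps functions of index `L` to functions of index `l L`,
and its adjugate intertwines the actions of the Heisenberg group in these two indices. Hence the sum
over `Γ \ {det = l}` defining `V_l` is again invariant under `Γ` and the lattice, and the growth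
condition is read off from upper triangular representatives, which map rational points to rational
points.

In rank one a matrix multiplies `φ` by a Gaussian in `z`. It therefore acts on the sequence `h` of
the Taylor coefficients of `φ` of a fixed parity by slashing `h_j` in weight `w + 2 j`, where `w` is
`k` or `k + 1`, and adding multiples of the lower entries. Up to normalization `𝒟_n φ` is the zeroth
entry obtained from `h` by the heat operators `h_j ↦ m D h_j - (j + 1) (j + w) h_{j+1}` in the
successive weights `w`, `w + 2`, and so on (Eichler–Zagier). Each of them intertwines the actions in
weights `w` and `w + 2`: the failure of `D` to commute with the slash action is the logarithmic
derivative of the automorphy factor, which is also the exponent of the Gaussian. The zeroth entry is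
acted on by the slash action in weight `k + n`, so `𝒟_n` turns each summand of `V_l` into the
corresponding summand of `T_l`.

At `i∞` the growth condition bounds `φ(τ, y)` for rational `y`. Since `φ` is `1`-periodic in `τ`,
the maximum principle in `q = e(τ)` controls the difference quotients between rational points by
their values on a horizontal line, which bounds all derivatives of `φ` at rational points.
-/

noncomputable section

namespace JacobiHecke

theorem e_add (x y : ℂ) : e (x + y) = e x * e y := by
  simp only [e, mul_add, Complex.exp_add]

theorem e_zero : e 0 = 1 := by simp [e]

theorem e_intCast (n : ℤ) : e n = 1 := by
  rw [e, Complex.exp_eq_one_iff]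
  exact ⟨n, by ring⟩

theorem differentiable_e : Differentiable ℂ e := by
  unfold e
  fun_prop

section Bilinear

variable {N N' : ℕ} (L : Matrix (Fin N) (Fin N) ℤ)

theorem bil_add_left (x y z : Fin N → ℂ) : bil L (x + y) z = bil L x z + bil L y z := by
  simp [bil, add_dotProduct]

theorem bil_add_right (x y z : Fin N → ℂ) : bil L x (y + z) = bil L x y + bil L x z := by
  simp [bil, mulVec_add]

theorem bil_sub_left (x y z : Fin N → ℂ) : bil L (x - y) z = bil L x z - bil L y z := by
  simp [bil, sub_dotProduct]

theorem bil_sub_right (x y z : Fin N → ℂ) : bil L x (y - z) = bil L x y - bil L x z := by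
  simp [bil, mulVec_sub]

theorem bil_smul_left (a : ℂ) (x y : Fin N → ℂ) : bil L (a • x) y = a * bil L x y := by
  simp [bil]

theorem bil_smul_right (a : ℂ) (x y : Fin N → ℂ) : bil L x (a • y) = a * bil L x y := by
  simp [bil, mulVec_smul]

theorem bil_zsmul (n : ℤ) (x y : Fin N → ℂ) : bil (n • L) x y = n * bil L x y := by
  have h : (n • L).map (Int.cast : ℤ → ℂ) = (n : ℂ) • L.map (Int.cast : ℤ → ℂ) := by
    ext i j
    simp only [map_apply, Matrix.smul_apply, smul_eq_mul, Int.cast_mul]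
  rw [bil, h, smul_mulVec, dotProduct_smul, smul_eq_mul, bil]

theorem bil_intCast (x y : Fin N → ℤ) :
    bil L (fun i => (x i : ℂ)) (fun i => (y i : ℂ)) = ((x ⬝ᵥ (L *ᵥ y) : ℤ) : ℂ) := by
  simp [bil, dotProduct, mulVec]

theorem bil_indexPullback (s : Matrix (Fin N) (Fin N') ℤ) (x y : Fin N' → ℂ) :
    bil (indexPullback L s) x y =
      bil L (s.map (Int.cast : ℤ → ℂ) *ᵥ x) (s.map (Int.cast : ℤ → ℂ) *ᵥ y) := by
  have h : (indexPullback L s).map (Int.cast : ℤ → ℂ) =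
      (s.map (Int.cast : ℤ → ℂ))ᵀ * L.map (Int.cast : ℤ → ℂ) * s.map (Int.cast : ℤ → ℂ) := by
    ext i j
    simp [indexPullback, mul_apply]
  rw [bil, bil, h, ← mulVec_mulVec, ← mulVec_mulVec, dotProduct_mulVec, vecMul_transpose]

theorem indexPullback_zsmul (a : ℤ) (s : Matrix (Fin N) (Fin N') ℤ) :
    indexPullback (a • L) s = a • indexPullback L s := by
  rw [indexPullback, indexPullback, Matrix.mul_smul, Matrix.smul_mul]

theorem quad_smul (a : ℂ) (x : Fin N → ℂ) : quad L (a • x) = a ^ 2 * quad L x := by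
  simp only [quad, bil_smul_left, bil_smul_right]
  ring

theorem quad_zsmul (n : ℤ) (x : Fin N → ℂ) : quad (n • L) x = n * quad L x :=
  bil_zsmul L n x x

theorem quad_indexPullback (s : Matrix (Fin N) (Fin N') ℤ) (x : Fin N' → ℂ) :
    quad (indexPullback L s) x = quad L (s.map (Int.cast : ℤ → ℂ) *ᵥ x) :=
  bil_indexPullback L s x x

theorem differentiable_quad : Differentiable ℂ (quad L) := by
  unfold quad bil
  simp only [dotProduct, mulVec]
  fun_prop

variable {L}

theorem bil_comm (hL : L.IsSymm) (x y : Fin N → ℂ) : bil L x y = bil L y x := by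
  have h : (L.map (Int.cast : ℤ → ℂ))ᵀ = L.map (Int.cast : ℤ → ℂ) := by
    rw [← transpose_map, hL.eq]
  rw [bil, bil, dotProduct_mulVec, dotProduct_comm, ← mulVec_transpose, h]

theorem quad_add (hL : L.IsSymm) (x y : Fin N → ℂ) :
    quad L (x + y) = quad L x + 2 * bil L x y + quad L y := by
  simp only [quad, bil_add_left, bil_add_right, bil_comm hL y x]
  ring

theorem quad_sub (hL : L.IsSymm) (x y : Fin N → ℂ) :
    quad L (x - y) = quad L x - 2 * bil L x y + quad L y := by
  simp only [quad, bil_sub_left, bil_sub_right, bil_comm hL y x]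
  ring

theorem even_dotProduct_mulVec (hL : IsJacobiIndex L) (x : Fin N → ℤ) :
    Even (x ⬝ᵥ (L *ᵥ x)) := by
  rw [← ZMod.intCast_eq_zero_iff_even]
  have h : ((x ⬝ᵥ (L *ᵥ x) : ℤ) : ZMod 2) =
      ∑ p : Fin N × Fin N, (x p.1 : ZMod 2) * ((L p.1 p.2 : ZMod 2) * (x p.2 : ZMod 2)) := by
    rw [Fintype.sum_prod_type]
    simp [dotProduct, mulVec, Finset.mul_sum]
  rw [h]
  -- modulo 2 the off-diagonal terms cancel in pairs and the diagonal ones vanish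
  refine Finset.sum_involution (fun p _ => p.swap) ?_ ?_ (by simp) (by simp)
  · rintro ⟨i, j⟩ -
    have hs : L j i = L i j := hL.symm.apply i j
    simp only [Prod.swap, hs]
    rw [show (x j : ZMod 2) * ((L i j : ZMod 2) * (x i : ZMod 2)) =
      x i * ((L i j : ZMod 2) * x j) by ring]
    exact CharTwo.add_self_eq_zero _
  · rintro ⟨i, j⟩ - hne heq
    obtain rfl : j = i := congrArg Prod.fst heq
    exact hne (by simp [(ZMod.intCast_eq_zero_iff_even).2 (hL.even_diag j)])

theorem exists_quad_intCast (hL : IsJacobiIndex L) (x : Fin N → ℤ) :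
    ∃ n : ℤ, quad L (fun i => (x i : ℂ)) = 2 * n := by
  obtain ⟨n, hn⟩ := even_dotProduct_mulVec hL x
  refine ⟨n, ?_⟩
  rw [quad, bil_intCast, hn]
  push_cast
  ring

end Bilinear

section Moebius

variable {M M' : Matrix (Fin 2) (Fin 2) ℤ}

/-- An integral matrix of positive determinant as an element of `GL₂(ℝ)`, through which Mathlib's
theory of the action on `ℍ` applies to `autFactor` and `moebius`. -/
def realGL (M : Matrix (Fin 2) (Fin 2) ℤ) (hM : 0 < M.det) : GL (Fin 2) ℝ :=
  .mkOfDetNeZero (M.map (Int.cast : ℤ → ℝ)) <| by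
    rw [← Int.cast_det]
    exact_mod_cast hM.ne'

theorem det_realGL (hM : 0 < M.det) : (realGL M hM).det.val = M.det :=
  (Int.cast_det M).symm

theorem det_realGL_pos (hM : 0 < M.det) : 0 < (realGL M hM).det.val := by
  rw [det_realGL]
  exact_mod_cast hM

theorem num_realGL (hM : 0 < M.det) (z : ℂ) :
    num (realGL M hM) z = (M 0 0 : ℂ) * z + (M 0 1 : ℂ) := by
  simp [num, realGL, Matrix.GeneralLinearGroup.mkOfDetNeZero]

theorem denom_realGL (hM : 0 < M.det) (τ : ℍ) : denom (realGL M hM) τ = autFactor M τ := by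
  simp [denom, autFactor, realGL, Matrix.GeneralLinearGroup.mkOfDetNeZero]

theorem realGL_mul (hM : 0 < M.det) (hM' : 0 < M'.det) (h : 0 < (M * M').det) :
    realGL (M * M') h = realGL M hM * realGL M' hM' := by
  apply Units.ext
  exact Matrix.map_mul_intCast M M'

theorem autFactor_ne_zero (hM : 0 < M.det) (τ : ℍ) : autFactor M τ ≠ 0 :=
  denom_realGL hM τ ▸ denom_ne_zero _ τ

theorem moebius_eq_smul (hM : 0 < M.det) (τ : ℍ) : moebius M τ = realGL M hM • τ := by
  rw [moebius, ← num_realGL hM, ← denom_realGL hM, ← coe_smul_of_det_pos (det_realGL_pos hM),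
    ofComplex_apply]

theorem coe_moebius (hM : 0 < M.det) (τ : ℍ) :
    (moebius M τ : ℂ) = ((M 0 0 : ℂ) * τ + (M 0 1 : ℂ)) / autFactor M τ := by
  rw [moebius_eq_smul hM, coe_smul_of_det_pos (det_realGL_pos hM), num_realGL, denom_realGL]

theorem moebius_mul (hM : 0 < M.det) (hM' : 0 < M'.det) (τ : ℍ) :
    moebius (M * M') τ = moebius M (moebius M' τ) := by
  have h : 0 < (M * M').det := by rw [det_mul]; exact mul_pos hM hM'
  rw [moebius_eq_smul h, moebius_eq_smul hM', moebius_eq_smul hM, realGL_mul hM hM', mul_smul]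

theorem autFactor_mul (hM : 0 < M.det) (hM' : 0 < M'.det) (τ : ℍ) :
    autFactor (M * M') τ = autFactor M (moebius M' τ) * autFactor M' τ := by
  have h : 0 < (M * M').det := by rw [det_mul]; exact mul_pos hM hM'
  rw [← denom_realGL h, realGL_mul hM hM', denom_cocycle _ _ τ.im_ne_zero, ← denom_realGL hM,
    ← denom_realGL hM', moebius_eq_smul hM', coe_smul_of_det_pos (det_realGL_pos hM')]

end Moebius

section Slash

variable {N N' : ℕ} (k : ℤ) (L : Matrix (Fin N) (Fin N) ℤ)

/-- The weight `k`, index `L` action of an integral matrix of positive determinant on functions on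
`ℍ × ℂ^N`; for determinant `l` it takes index `L` to index `l L`. -/
def slashMat (M : Matrix (Fin 2) (Fin 2) ℤ) :
    (ℍ → (Fin N → ℂ) → ℂ) →ₗ[ℂ] ℍ → (Fin N → ℂ) → ℂ where
  toFun φ τ z := autFactor M τ ^ (-k) *
    e (-(M 1 0 : ℂ) * (M.det * quad L z) / (2 * autFactor M τ)) *
    φ (moebius M τ) ((M.det / autFactor M τ : ℂ) • z)
  map_add' φ ψ := by
    ext τ z
    simp only [Pi.add_apply]
    ring
  map_smul' c φ := by
    ext τ z
    simp only [Pi.smul_apply, smul_eq_mul, RingHom.id_apply]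
    ring

/-- The index `L` action of the pair `(x, y)` of the Heisenberg group on functions on `ℍ × ℂ^N`.
The pair may be complex, so that both the invariance (integral pairs) and the growth condition
(rational pairs) of Jacobi forms are statements about this action. -/
def heisSlash (x y : Fin N → ℂ) : (ℍ → (Fin N → ℂ) → ℂ) →ₗ[ℂ] ℍ → (Fin N → ℂ) → ℂ where
  toFun φ τ z := e (τ * quad L x / 2 + bil L x z) * φ τ (z + ((τ : ℂ) • x + y))
  map_add' φ ψ := by
    ext τ z
    simp only [Pi.add_apply, mul_add]
  map_smul' c φ := by
    ext τ z
    simp only [Pi.smul_apply, smul_eq_mul, RingHom.id_apply]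
    ring

variable {k L}

theorem slashMat_apply (M : Matrix (Fin 2) (Fin 2) ℤ) (φ : ℍ → (Fin N → ℂ) → ℂ) (τ : ℍ)
    (z : Fin N → ℂ) :
    slashMat k L M φ τ z = autFactor M τ ^ (-k) *
      e (-(M 1 0 : ℂ) * (M.det * quad L z) / (2 * autFactor M τ)) *
      φ (moebius M τ) ((M.det / autFactor M τ : ℂ) • z) := rfl

theorem heisSlash_apply (x y : Fin N → ℂ) (φ : ℍ → (Fin N → ℂ) → ℂ) (τ : ℍ) (z : Fin N → ℂ) :
    heisSlash L x y φ τ z =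
      e (τ * quad L x / 2 + bil L x z) * φ τ (z + ((τ : ℂ) • x + y)) := rfl

theorem slashMat_one (φ : ℍ → (Fin N → ℂ) → ℂ) : slashMat k L 1 φ = φ := by
  ext τ z
  have haut : autFactor 1 τ = 1 := by simp [autFactor]
  have hmoeb : moebius 1 τ = τ := UpperHalfPlane.ext <| by
    rw [coe_moebius (by simp), haut]
    simp
  simp [slashMat_apply, haut, hmoeb, e_zero]

theorem heisSlash_zero (φ : ℍ → (Fin N → ℂ) → ℂ) : heisSlash L 0 0 φ = φ := by
  ext τ z
  simp [heisSlash_apply, quad, bil, e_zero]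

theorem exponent_slashMat_mul {M M' : Matrix (Fin 2) (Fin 2) ℤ} (hM : 0 < M.det)
    (hM' : 0 < M'.det) (τ : ℍ) (q : ℂ) :
    -(M' 1 0 : ℂ) * (M'.det * (M.det * q)) / (2 * autFactor M' τ) +
        -(M 1 0 : ℂ) * (M.det * ((M'.det / autFactor M' τ) ^ 2 * q)) /
          (2 * autFactor M (moebius M' τ)) =
      -((M * M') 1 0 : ℂ) * ((M.det * M'.det : ℤ) * q) /
        (2 * (autFactor M (moebius M' τ) * autFactor M' τ)) := by
  have hJ' := autFactor_ne_zero hM' τ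
  have hJ := autFactor_ne_zero hM (moebius M' τ)
  have key : (M' 1 0 : ℂ) * (autFactor M (moebius M' τ) * autFactor M' τ) +
      (M 1 0 : ℂ) * M'.det = ((M * M') 1 0 : ℂ) * autFactor M' τ := by
    rw [← autFactor_mul hM hM', det_fin_two]
    simp only [autFactor, mul_apply, Fin.sum_univ_two]
    push_cast
    ring
  field_simp
  rw [Int.cast_mul]
  linear_combination (-(M'.det : ℂ) * (M.det : ℂ) * q) * key

theorem slashMat_mul {M M' : Matrix (Fin 2) (Fin 2) ℤ} (hM : 0 < M.det) (hM' : 0 < M'.det)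
    (φ : ℍ → (Fin N → ℂ) → ℂ) :
    slashMat k (M.det • L) M' (slashMat k L M φ) = slashMat k L (M * M') φ := by
  ext τ z
  have harg : (M.det / autFactor M (moebius M' τ) * (M'.det / autFactor M' τ) : ℂ) =
      (M.det * M'.det : ℤ) / (autFactor M (moebius M' τ) * autFactor M' τ) := by
    rw [Int.cast_mul, div_mul_div_comm]
  simp only [slashMat_apply, autFactor_mul hM hM', moebius_mul hM hM', smul_smul, quad_smul,
    quad_zsmul, det_mul, mul_zpow, ← exponent_slashMat_mul hM hM', e_add, harg]
  ring

theorem exponent_heisSlash_slashMat (hL : L.IsSymm) {M : Matrix (Fin 2) (Fin 2) ℤ}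
    (hM : 0 < M.det) (x y z : Fin N → ℂ) (τ : ℍ) :
    τ * quad (M.det • L) x / 2 + bil (M.det • L) x z +
        -(M 1 0 : ℂ) * (M.det * quad L (z + ((τ : ℂ) • x + y))) / (2 * autFactor M τ) =
      (M 0 1 * M 1 0 * bil L x y -
          (M 0 1 * M 1 1 * quad L x + M 0 0 * M 1 0 * quad L y) / 2) +
        -(M 1 0 : ℂ) * (M.det * quad L z) / (2 * autFactor M τ) +
        (moebius M τ * quad L ((M 1 1 : ℂ) • x - (M 1 0 : ℂ) • y) / 2 +
          bil L ((M 1 1 : ℂ) • x - (M 1 0 : ℂ) • y) ((M.det / autFactor M τ : ℂ) • z)) := by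
  have hJ := autFactor_ne_zero hM τ
  rw [coe_moebius hM]
  simp only [quad_zsmul, bil_zsmul, quad_add hL, quad_sub hL, quad_smul, bil_add_left,
    bil_sub_left, bil_smul_left, bil_smul_right, bil_comm hL z]
  field_simp
  simp only [autFactor, det_fin_two]
  push_cast
  ring

theorem argument_heisSlash_slashMat {M : Matrix (Fin 2) (Fin 2) ℤ} (hM : 0 < M.det)
    (x y z : Fin N → ℂ) (τ : ℍ) :
    (M.det / autFactor M τ : ℂ) • (z + ((τ : ℂ) • x + y)) =
      (M.det / autFactor M τ : ℂ) • z +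
        ((moebius M τ : ℂ) • ((M 1 1 : ℂ) • x - (M 1 0 : ℂ) • y) +
          ((M 0 0 : ℂ) • y - (M 0 1 : ℂ) • x)) := by
  have hJ := autFactor_ne_zero hM τ
  rw [coe_moebius hM]
  ext i
  simp only [Pi.add_apply, Pi.sub_apply, Pi.smul_apply, smul_eq_mul]
  field_simp
  simp only [autFactor, det_fin_two]
  push_cast
  ring

-- `(d x - c y, a y - b x)` is the row vector `(x, y)` times the adjugate of `M`.
theorem heisSlash_slashMat (hL : L.IsSymm) {M : Matrix (Fin 2) (Fin 2) ℤ} (hM : 0 < M.det)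
    (x y : Fin N → ℂ) (φ : ℍ → (Fin N → ℂ) → ℂ) :
    heisSlash (M.det • L) x y (slashMat k L M φ) =
      e (M 0 1 * M 1 0 * bil L x y -
          (M 0 1 * M 1 1 * quad L x + M 0 0 * M 1 0 * quad L y) / 2) •
        slashMat k L M (heisSlash L ((M 1 1 : ℂ) • x - (M 1 0 : ℂ) • y)
          ((M 0 0 : ℂ) • y - (M 0 1 : ℂ) • x) φ) := by
  ext τ z
  have hexp := congrArg e (exponent_heisSlash_slashMat hL hM x y z τ)
  rw [e_add, e_add (_ - _ + _), e_add (_ - _)] at hexp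
  simp only [heisSlash_apply, slashMat_apply, Pi.smul_apply, smul_eq_mul,
    argument_heisSlash_slashMat hM]
  linear_combination autFactor M τ ^ (-k) * φ (moebius M τ) ((M.det / autFactor M τ : ℂ) • z +
    ((moebius M τ : ℂ) • ((M 1 1 : ℂ) • x - (M 1 0 : ℂ) • y) +
      ((M 0 0 : ℂ) • y - (M 0 1 : ℂ) • x))) * hexp

theorem heisSlash_slashMat_of_invariant (hL : IsJacobiIndex L) {M : Matrix (Fin 2) (Fin 2) ℤ}
    (hM : 0 < M.det) {φ : ℍ → (Fin N → ℂ) → ℂ}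
    (hφ : ∀ lam mu : Fin N → ℤ, heisSlash L (fun i => (lam i : ℂ)) (fun i => (mu i : ℂ)) φ = φ)
    (lam mu : Fin N → ℤ) :
    heisSlash (M.det • L) (fun i => (lam i : ℂ)) (fun i => (mu i : ℂ)) (slashMat k L M φ) =
      slashMat k L M φ := by
  obtain ⟨p, hp⟩ := exists_quad_intCast hL lam
  obtain ⟨q, hq⟩ := exists_quad_intCast hL mu
  have hscalar := e_intCast (M 0 1 * M 1 0 * (lam ⬝ᵥ (L *ᵥ mu)) -
    (M 0 1 * M 1 1 * p + M 0 0 * M 1 0 * q))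
  have hinv := hφ (M 1 1 • lam - M 1 0 • mu) (M 0 0 • mu - M 0 1 • lam)
  have hsub (a b : ℤ) (u v : Fin N → ℤ) : (fun i => ((a • u - b • v) i : ℂ)) =
      (a : ℂ) • (fun i => (u i : ℂ)) - (b : ℂ) • fun i => (v i : ℂ) := by
    ext i
    simp
  rw [hsub, hsub] at hinv
  rw [heisSlash_slashMat hL.symm hM, hinv, hp, hq, bil_intCast]
  convert one_smul ℂ (slashMat k L M φ) using 2
  rw [← hscalar]
  congr 1
  push_cast
  ring

theorem slashMat_restrict (M : Matrix (Fin 2) (Fin 2) ℤ) (s : Matrix (Fin N) (Fin N') ℤ)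
    (φ : ℍ → (Fin N → ℂ) → ℂ) :
    slashMat k (indexPullback L s) M (restrict s φ) = restrict s (slashMat k L M φ) := by
  ext τ z
  simp only [slashMat_apply, restrict, quad_indexPullback, mulVec_smul]

theorem heisSlash_restrict (x y : Fin N' → ℂ) (s : Matrix (Fin N) (Fin N') ℤ)
    (φ : ℍ → (Fin N → ℂ) → ℂ) :
    heisSlash (indexPullback L s) x y (restrict s φ) =
      restrict s (heisSlash L (s.map (Int.cast : ℤ → ℂ) *ᵥ x)
        (s.map (Int.cast : ℤ → ℂ) *ᵥ y) φ) := by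
  ext τ z
  simp only [heisSlash_apply, restrict, quad_indexPullback, bil_indexPullback, mulVec_add,
    mulVec_smul]

theorem jacobiSlash_eq_heisSlash (γ : SL(2, ℤ)) (lam mu : Fin N → ℤ) (φ : ℍ → (Fin N → ℂ) → ℂ) :
    jacobiSlash k L γ lam mu φ =
      heisSlash L (fun i => (lam i : ℂ)) (fun i => (mu i : ℂ)) (slashMat k L γ.1 φ) := by
  ext τ z
  have hw : (fun i => z i + (lam i : ℂ) * τ + (mu i : ℂ)) =
      z + ((τ : ℂ) • (fun i => (lam i : ℂ)) + fun i => (mu i : ℂ)) := by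
    ext i
    simp only [Pi.add_apply, Pi.smul_apply, smul_eq_mul]
    ring
  have hdiv (w : Fin N → ℂ) : (fun i => w i / autFactor γ.1 τ) = (1 / autFactor γ.1 τ) • w := by
    ext i
    simp only [Pi.smul_apply, smul_eq_mul]
    ring
  simp only [jacobiSlash, heisSlash_apply, slashMat_apply, γ.2, Int.cast_one, one_mul]
  rw [hdiv, hw, add_assoc, e_add]
  ring

theorem jacobiSlash_zero_eq_slashMat (γ : SL(2, ℤ)) (φ : ℍ → (Fin N → ℂ) → ℂ) :
    jacobiSlash k L γ 0 0 φ = slashMat k L γ.1 φ := by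
  rw [jacobiSlash_eq_heisSlash]
  simpa [Pi.zero_def] using heisSlash_zero (slashMat k L γ.1 φ)

theorem jacobiSlash_invariant_iff {φ : ℍ → (Fin N → ℂ) → ℂ} :
    (∀ (γ : SL(2, ℤ)) (lam mu : Fin N → ℤ), jacobiSlash k L γ lam mu φ = φ) ↔
      (∀ γ : SL(2, ℤ), slashMat k L γ.1 φ = φ) ∧
        ∀ lam mu : Fin N → ℤ,
          heisSlash L (fun i => (lam i : ℂ)) (fun i => (mu i : ℂ)) φ = φ := by
  refine ⟨fun h => ⟨fun γ => jacobiSlash_zero_eq_slashMat γ φ ▸ h γ 0 0, fun lam mu => ?_⟩,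
    fun h γ lam mu => by rw [jacobiSlash_eq_heisSlash, h.1, h.2]⟩
  simpa [jacobiSlash_eq_heisSlash, slashMat_one] using h 1 lam mu

end Slash

section Cosets

variable {l : ℕ}

theorem det_pos_of_SL (γ : SL(2, ℤ)) : 0 < γ.1.det := by
  rw [γ.2]
  exact one_pos

theorem det_pos_of_fixedDet [NeZero l] (M : FixedDetMatrix (Fin 2) ℤ (l : ℤ)) : 0 < M.1.det := by
  rw [M.2]
  exact_mod_cast NeZero.pos l

instance HeckeCosets.instFinite [NeZero l] : Finite (HeckeCosets l) :=
  finite_heckeCosets l (NeZero.pos l)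

instance HeckeCosets.instFintype [NeZero l] : Fintype (HeckeCosets l) := Fintype.ofFinite _

theorem exists_smul_upperTriangular [NeZero l] (M : FixedDetMatrix (Fin 2) ℤ (l : ℤ)) :
    ∃ γ : SL(2, ℤ), (γ • M).1 1 0 = 0 := by
  refine FixedDetMatrices.induction_on (C := fun B => ∃ γ : SL(2, ℤ), (γ • B).1 1 0 = 0)
    (by exact_mod_cast NeZero.ne l) (fun A h _ _ _ => ⟨1, by rwa [one_smul]⟩) ?_ ?_
  · rintro B ⟨γ, hγ⟩
    exact ⟨γ * ModularGroup.S⁻¹, by rwa [mul_smul, inv_smul_smul]⟩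
  · rintro B ⟨γ, hγ⟩
    exact ⟨γ * ModularGroup.T⁻¹, by rwa [mul_smul, inv_smul_smul]⟩

/-- Right multiplication by `γ ∈ SL₂(ℤ)` on the integral matrices of determinant `l`. -/
def mulRight (γ : SL(2, ℤ)) :
    FixedDetMatrix (Fin 2) ℤ (l : ℤ) ≃ FixedDetMatrix (Fin 2) ℤ (l : ℤ) :=
  (Units.mulRight (Matrix.SpecialLinearGroup.toGL γ)).subtypeEquiv fun A => by
    simp [det_mul]

theorem coe_mulRight (γ : SL(2, ℤ)) (M : FixedDetMatrix (Fin 2) ℤ (l : ℤ)) :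
    (mulRight γ M).1 = M.1 * γ.1 :=
  rfl

theorem smul_mulRight (g γ : SL(2, ℤ)) (M : FixedDetMatrix (Fin 2) ℤ (l : ℤ)) :
    mulRight γ (g • M) = g • mulRight γ M :=
  FixedDetMatrices.ext' _ _ (Matrix.mul_assoc g.1 M.1 γ.1)

/-- The permutation of the Hecke cosets induced by `mulRight γ`. -/
def cosetPerm (γ : SL(2, ℤ)) : HeckeCosets l ≃ HeckeCosets l :=
  Quotient.congr (mulRight γ) fun A B => by
    simp only [MulAction.orbitRel_apply, MulAction.mem_orbit_iff, ← smul_mulRight,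
      (mulRight γ).apply_eq_iff_eq]

theorem apply_out_mk {V : Type*} {F : FixedDetMatrix (Fin 2) ℤ (l : ℤ) → V}
    (hF : ∀ (g : SL(2, ℤ)) M, F (g • M) = F M) (M : FixedDetMatrix (Fin 2) ℤ (l : ℤ)) :
    F (Quotient.out (Quotient.mk _ M : HeckeCosets l)) = F M := by
  obtain ⟨g, hg⟩ : (MulAction.orbitRel SL(2, ℤ) _).r
    (Quotient.out (Quotient.mk _ M : HeckeCosets l)) M := Quotient.mk_out M
  rw [← hg]
  exact hF g M

theorem sum_mulRight_out [NeZero l] {V : Type*} [AddCommMonoid V]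
    {F : FixedDetMatrix (Fin 2) ℤ (l : ℤ) → V} (hF : ∀ (g : SL(2, ℤ)) M, F (g • M) = F M)
    (γ : SL(2, ℤ)) :
    ∑ q : HeckeCosets l, F (mulRight γ (Quotient.out q)) =
      ∑ q : HeckeCosets l, F (Quotient.out q) := by
  rw [← (cosetPerm γ).sum_comp fun q => F (Quotient.out q)]
  refine Finset.sum_congr rfl fun q _ => ?_
  have hq : cosetPerm γ q = Quotient.mk _ (mulRight γ (Quotient.out q)) := by
    conv_lhs => rw [← Quotient.out_eq q]
    rfl
  rw [hq, apply_out_mk hF]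

end Cosets

section HeckeOperator

variable {N N' : ℕ} {k : ℤ} {L : Matrix (Fin N) (Fin N) ℤ} {l : ℕ}
  {φ : ℍ → (Fin N → ℂ) → ℂ}

theorem heckeVTerm_eq_slashMat (φ : ℍ → (Fin N → ℂ) → ℂ)
    (M : FixedDetMatrix (Fin 2) ℤ (l : ℤ)) :
    heckeVTerm k L l φ M = slashMat k L M.1 φ := by
  ext τ z
  simp only [heckeVTerm, slashMat_apply, M.2, Int.cast_natCast]
  congr 2
  ext i
  simp only [Pi.smul_apply, smul_eq_mul]
  ring

theorem heckeV_restrict (l : ℕ) (s : Matrix (Fin N) (Fin N') ℤ) (φ : ℍ → (Fin N → ℂ) → ℂ) :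
    heckeV k (indexPullback L s) l (restrict s φ) = restrict s (heckeV k L l φ) := by
  ext τ z
  simp only [heckeV, heckeVTerm_eq_slashMat, slashMat_restrict, restrict]

variable [NeZero l]

theorem heckeV_eq_sum (φ : ℍ → (Fin N → ℂ) → ℂ) :
    heckeV k L l φ =
      (l : ℂ) ^ (k - 1) • ∑ q : HeckeCosets l, slashMat k L (Quotient.out q).1 φ := by
  ext τ z
  simp only [heckeV, finsum_eq_sum_of_fintype, heckeVTerm_eq_slashMat, Pi.smul_apply,
    Finset.sum_apply, smul_eq_mul]

theorem slashMat_smul_of_invariant (hφ : ∀ γ : SL(2, ℤ), slashMat k L γ.1 φ = φ) (γ : SL(2, ℤ))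
    (M : FixedDetMatrix (Fin 2) ℤ (l : ℤ)) :
    slashMat k L (γ • M).1 φ = slashMat k L M.1 φ := by
  have h := slashMat_mul (k := k) (L := L) (det_pos_of_SL γ) (det_pos_of_fixedDet M) φ
  rw [FixedDetMatrices.smul_coe, ← h, hφ, γ.2, one_smul]

theorem slashMat_heckeV (hφ : ∀ γ : SL(2, ℤ), slashMat k L γ.1 φ = φ) (γ : SL(2, ℤ)) :
    slashMat k ((l : ℤ) • L) γ.1 (heckeV k L l φ) = heckeV k L l φ := by
  have hterm (q : HeckeCosets l) :
      slashMat k ((l : ℤ) • L) γ.1 (slashMat k L (Quotient.out q).1 φ) =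
        slashMat k L (mulRight γ (Quotient.out q)).1 φ := by
    have h := slashMat_mul (k := k) (L := L) (det_pos_of_fixedDet (Quotient.out q))
      (det_pos_of_SL γ) φ
    rwa [(Quotient.out q).2] at h
  simp only [heckeV_eq_sum, map_smul, map_sum, hterm]
  exact congrArg _ (sum_mulRight_out (F := fun M => slashMat k L M.1 φ)
    (slashMat_smul_of_invariant hφ) γ)

theorem heisSlash_heckeV (hL : IsJacobiIndex L)
    (hφ : ∀ lam mu : Fin N → ℤ, heisSlash L (fun i => (lam i : ℂ)) (fun i => (mu i : ℂ)) φ = φ)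
    (lam mu : Fin N → ℤ) :
    heisSlash ((l : ℤ) • L) (fun i => (lam i : ℂ)) (fun i => (mu i : ℂ)) (heckeV k L l φ) =
      heckeV k L l φ := by
  have hterm (q : HeckeCosets l) := by
    have h := heisSlash_slashMat_of_invariant (k := k) hL (det_pos_of_fixedDet (Quotient.out q))
      hφ lam mu
    rwa [(Quotient.out q).2] at h
  simp only [heckeV_eq_sum, map_smul, map_sum, hterm]

end HeckeOperator

section Holomorphy

variable {N N' : ℕ} {k : ℤ} {L : Matrix (Fin N) (Fin N) ℤ} {φ : ℍ → (Fin N → ℂ) → ℂ}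

/-- Holomorphy of a function on `ℍ × ℂ^N`, as required of Jacobi forms. -/
def IsHolo (φ : ℍ → (Fin N → ℂ) → ℂ) : Prop :=
  DifferentiableOn ℂ (fun p : ℂ × (Fin N → ℂ) => φ (ofComplex p.1) p.2)
    {p : ℂ × (Fin N → ℂ) | 0 < p.1.im}

theorem coe_ofComplex {t : ℂ} (ht : 0 < t.im) : (ofComplex t : ℂ) = t := by
  rw [ofComplex_apply_of_im_pos ht]

theorem differentiableOn_autFactor (M : Matrix (Fin 2) (Fin 2) ℤ) :
    DifferentiableOn ℂ (fun t => autFactor M (ofComplex t)) {t | 0 < t.im} :=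
  DifferentiableOn.congr (f := fun t => (M 1 0 : ℂ) * t + M 1 1) (by fun_prop) fun t ht => by
    rw [autFactor, coe_ofComplex ht]

theorem differentiableOn_moebius {M : Matrix (Fin 2) (Fin 2) ℤ} (hM : 0 < M.det) :
    DifferentiableOn ℂ (fun t => (moebius M (ofComplex t) : ℂ)) {t | 0 < t.im} := by
  have hnum : DifferentiableOn ℂ (fun t : ℂ => (M 0 0 : ℂ) * t + M 0 1) {t | 0 < t.im} := by
    fun_prop
  refine (hnum.div (differentiableOn_autFactor M) fun t _ => autFactor_ne_zero hM _).congr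
    fun t ht => ?_
  rw [coe_moebius hM, coe_ofComplex ht, Pi.div_apply]

theorem IsHolo.slashMat (hφ : IsHolo φ) {M : Matrix (Fin 2) (Fin 2) ℤ} (hM : 0 < M.det) :
    IsHolo (slashMat k L M φ) := by
  have hmaps : Set.MapsTo Prod.fst {p : ℂ × (Fin N → ℂ) | 0 < p.1.im} {t | 0 < t.im} :=
    fun p hp => hp
  have haut : DifferentiableOn ℂ (fun p : ℂ × (Fin N → ℂ) => autFactor M (ofComplex p.1))
      {p | 0 < p.1.im} := (differentiableOn_autFactor M).comp differentiableOn_fst hmaps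
  have hne (p : ℂ × (Fin N → ℂ)) : autFactor M (ofComplex p.1) ≠ 0 := autFactor_ne_zero hM _
  have hquad : DifferentiableOn ℂ (fun p : ℂ × (Fin N → ℂ) =>
      -(M 1 0 : ℂ) * (M.det * quad L p.2)) {p | 0 < p.1.im} :=
    (((differentiable_quad L).comp differentiable_snd).const_mul _ |>.const_mul _).differentiableOn
  have hexp : DifferentiableOn ℂ (fun p : ℂ × (Fin N → ℂ) =>
      e (-(M 1 0 : ℂ) * (M.det * quad L p.2) / (2 * autFactor M (ofComplex p.1))))
      {p | 0 < p.1.im} :=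
    differentiable_e.comp_differentiableOn <| by
      simpa only [div_eq_mul_inv] using
        hquad.fun_mul ((haut.const_mul 2).fun_inv fun p _ => mul_ne_zero two_ne_zero (hne p))
  have hpoint : DifferentiableOn ℂ (fun p : ℂ × (Fin N → ℂ) =>
      ((moebius M (ofComplex p.1) : ℂ), (M.det / autFactor M (ofComplex p.1) : ℂ) • p.2))
      {p | 0 < p.1.im} :=
    ((differentiableOn_moebius hM).comp differentiableOn_fst hmaps).prodMk <| by
      simpa only [div_eq_mul_inv] using
        ((haut.fun_inv fun p _ => hne p).const_mul (M.det : ℂ)).fun_smul differentiableOn_snd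
  refine ((haut.zpow (m := -k) (Or.inl fun p _ => hne p)).mul hexp |>.mul
    (hφ.comp hpoint fun p _ => (moebius M _).im_pos)).congr fun p _ => ?_
  simp only [slashMat_apply, Function.comp_apply, Pi.mul_apply, ofComplex_apply]

theorem IsHolo.heckeV {l : ℕ} [NeZero l] (hφ : IsHolo φ) : IsHolo (heckeV k L l φ) := by
  unfold IsHolo
  simp only [heckeV_eq_sum, Pi.smul_apply, Finset.sum_apply, smul_eq_mul]
  exact (DifferentiableOn.fun_sum fun (q : HeckeCosets l) _ =>
    hφ.slashMat (det_pos_of_fixedDet (Quotient.out q))).const_mul _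

theorem IsHolo.restrict (hφ : IsHolo φ) (s : Matrix (Fin N) (Fin N') ℤ) :
    IsHolo (restrict s φ) := by
  have hs : Differentiable ℂ fun p : ℂ × (Fin N' → ℂ) =>
      (p.1, s.map (Int.cast : ℤ → ℂ) *ᵥ p.2) :=
    differentiable_fst.prodMk (differentiable_pi.2 fun i => by
      simp only [mulVec, dotProduct]
      fun_prop)
  exact hφ.comp hs.differentiableOn fun p hp => hp

end Holomorphy

section Growth

variable {N N' : ℕ} {k : ℤ} {L : Matrix (Fin N) (Fin N) ℤ} {φ : ℍ → (Fin N → ℂ) → ℂ}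

/-- The growth condition of Jacobi forms at infinity, `e(τ L[α] / 2) φ(τ, α τ + β) = O(1)` for
rational `α` and `β`, expressed through the Heisenberg action. -/
def IsBddAtCusp (L : Matrix (Fin N) (Fin N) ℤ) (φ : ℍ → (Fin N → ℂ) → ℂ) : Prop :=
  ∀ α β : Fin N → ℚ, IsBoundedAtImInfty fun τ =>
    heisSlash L (fun i => (α i : ℂ)) (fun i => (β i : ℂ)) φ τ 0

theorem tendsto_moebius_atImInfty {M : Matrix (Fin 2) (Fin 2) ℤ} (hM : 0 < M.det)
    (hc : M 1 0 = 0) : Filter.Tendsto (moebius M) atImInfty atImInfty := by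
  rw [funext (moebius_eq_smul hM)]
  refine tendsto_smul_atImInfty ?_
  simp [realGL, Matrix.GeneralLinearGroup.mkOfDetNeZero, hc]

theorem IsBddAtCusp.slashMat (hφ : IsBddAtCusp L φ) (hL : L.IsSymm)
    {M : Matrix (Fin 2) (Fin 2) ℤ} (hM : 0 < M.det) (hc : M 1 0 = 0) :
    IsBddAtCusp (M.det • L) (slashMat k L M φ) := by
  intro α β
  have hbdd := (hφ (M 1 1 • α - M 1 0 • β) (M 0 0 • β - M 0 1 • α)).comp_tendsto
    (tendsto_moebius_atImInfty hM hc)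
  have hsub (a b : ℤ) (u v : Fin N → ℚ) : (fun i => ((a • u - b • v) i : ℂ)) =
      (a : ℂ) • (fun i => (u i : ℂ)) - (b : ℂ) • fun i => (v i : ℂ) := by
    ext i
    simp
  simp only [hsub] at hbdd
  simp only [IsBoundedAtImInfty, Filter.BoundedAtFilter, heisSlash_slashMat hL hM, Pi.smul_apply,
    smul_eq_mul]
  refine Asymptotics.IsBigO.const_mul_left ?_ _
  refine (hbdd.const_mul_left ((M 1 1 : ℂ) ^ (-k))).congr_left fun τ => ?_
  simp [slashMat_apply, autFactor, hc, e_zero]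

theorem IsBddAtCusp.heckeV {l : ℕ} [NeZero l] (hφ : IsBddAtCusp L φ) (hL : L.IsSymm)
    (hinv : ∀ γ : SL(2, ℤ), JacobiHecke.slashMat k L γ.1 φ = φ) :
    IsBddAtCusp ((l : ℤ) • L) (heckeV k L l φ) := by
  have hterm (q : HeckeCosets l) :
      IsBddAtCusp ((l : ℤ) • L) (JacobiHecke.slashMat k L (Quotient.out q).1 φ) := by
    obtain ⟨γ, hγ⟩ := exists_smul_upperTriangular (Quotient.out q)
    have h := hφ.slashMat (k := k) hL (det_pos_of_fixedDet (γ • Quotient.out q)) hγ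
    rwa [slashMat_smul_of_invariant hinv, (γ • Quotient.out q).2] at h
  intro α β
  simp only [heckeV_eq_sum, map_smul, map_sum, Pi.smul_apply, Finset.sum_apply, smul_eq_mul]
  exact (Asymptotics.IsBigO.fun_sum fun q _ => hterm q α β).const_mul_left _

theorem IsBddAtCusp.restrict (hφ : IsBddAtCusp L φ) (s : Matrix (Fin N) (Fin N') ℤ) :
    IsBddAtCusp (indexPullback L s) (restrict s φ) := by
  intro α β
  have hs (x : Fin N' → ℚ) : (s.map (Int.cast : ℤ → ℂ) *ᵥ fun i => (x i : ℂ)) =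
      fun i => ((s.map (Int.cast : ℤ → ℚ) *ᵥ x) i : ℂ) := by
    ext i
    simp [mulVec, dotProduct]
  simpa only [heisSlash_restrict, hs, JacobiHecke.restrict, mulVec_zero] using
    hφ (s.map (Int.cast : ℤ → ℚ) *ᵥ α) (s.map (Int.cast : ℤ → ℚ) *ᵥ β)

end Growth

section JacobiForm

variable {N N' : ℕ} {k : ℤ} {L : Matrix (Fin N) (Fin N) ℤ} {φ : ℍ → (Fin N → ℂ) → ℂ}

theorem isJacobiForm_iff : IsJacobiForm k L φ ↔
    IsHolo φ ∧ (∀ γ : SL(2, ℤ), slashMat k L γ.1 φ = φ) ∧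
      (∀ lam mu : Fin N → ℤ,
        heisSlash L (fun i => (lam i : ℂ)) (fun i => (mu i : ℂ)) φ = φ) ∧
      IsBddAtCusp L φ := by
  have hbdd : IsBddAtCusp L φ ↔ ∀ α β : Fin N → ℚ, IsBoundedAtImInfty (fun τ : ℍ =>
      e (τ * quad L (fun i => (α i : ℂ)) / 2) * φ τ (fun i => (α i : ℂ) * τ + (β i : ℂ))) := by
    refine forall₂_congr fun α β => iff_of_eq (congrArg _ (funext fun τ => ?_))
    have hpoint : (τ : ℂ) • (fun i => (α i : ℂ)) + (fun i => (β i : ℂ)) =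
        fun i => (α i : ℂ) * τ + (β i : ℂ) := by
      ext i
      simp [mul_comm]
    simp [heisSlash_apply, bil, hpoint]
  rw [← and_assoc (a := ∀ γ : SL(2, ℤ), _), ← jacobiSlash_invariant_iff, hbdd]
  exact ⟨fun h => ⟨h.holo, h.invariant, h.bounded⟩, fun h => ⟨h.1, h.2.1, h.2.2⟩⟩

theorem IsJacobiForm.slashMat_eq (hφ : IsJacobiForm k L φ) (γ : SL(2, ℤ)) :
    slashMat k L γ.1 φ = φ :=
  (isJacobiForm_iff.1 hφ).2.1 γ

theorem IsJacobiForm.heckeV {l : ℕ} [NeZero l] (hL : IsJacobiIndex L) (hφ : IsJacobiForm k L φ) :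
    IsJacobiForm k ((l : ℤ) • L) (heckeV k L l φ) := by
  obtain ⟨hholo, hmod, hheis, hbdd⟩ := isJacobiForm_iff.1 hφ
  exact isJacobiForm_iff.2 ⟨hholo.heckeV, slashMat_heckeV hmod, heisSlash_heckeV hL hheis,
    hbdd.heckeV hL.symm hmod⟩

theorem IsJacobiForm.restrict (hφ : IsJacobiForm k L φ) (s : Matrix (Fin N) (Fin N') ℤ) :
    IsJacobiForm k (indexPullback L s) (restrict s φ) := by
  obtain ⟨hholo, hmod, hheis, hbdd⟩ := isJacobiForm_iff.1 hφ
  have hs (x : Fin N' → ℤ) : (s.map (Int.cast : ℤ → ℂ) *ᵥ fun i => (x i : ℂ)) =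
      fun i => ((s *ᵥ x) i : ℂ) := by
    ext i
    simp [mulVec, dotProduct]
  exact isJacobiForm_iff.2 ⟨hholo.restrict s, fun γ => by rw [slashMat_restrict, hmod],
    fun lam mu => by rw [heisSlash_restrict, hs, hs, hheis], hbdd.restrict s⟩

end JacobiForm

section TwoVariables

open Filter Topology Metric

/-- The partial derivative in the first variable. -/
def dFst (F : ℂ → ℂ → ℂ) : ℂ → ℂ → ℂ := fun t z => deriv (fun s => F s z) t

/-- The partial derivative in the second variable. -/
def dSnd (F : ℂ → ℂ → ℂ) : ℂ → ℂ → ℂ := fun t z => deriv (F t) z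

/-- Separately holomorphic, locally bounded functions on `U × V`. -/
structure SepHolo (U V : Set ℂ) (F : ℂ → ℂ → ℂ) : Prop where
  left : ∀ z ∈ V, DifferentiableOn ℂ (fun t => F t z) U
  right : ∀ t ∈ U, DifferentiableOn ℂ (F t) V
  locBdd : ∀ t ∈ U, ∀ z ∈ V, ∃ C, ∀ᶠ p in 𝓝 t ×ˢ 𝓝 z, ‖F p.1 p.2‖ ≤ C

theorem norm_deriv_le_of_norm_le {f : ℂ → ℂ} {c : ℂ} {R C : ℝ} (hR : 0 < R)
    (hf : DifferentiableOn ℂ f (ball c R)) (hC : ∀ t ∈ ball c R, ‖f t‖ ≤ C) :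
    ‖deriv f c‖ ≤ 2 * C / R :=
  Complex.norm_deriv_le_div_of_mapsTo_ball hf (fun t ht => mem_closedBall_iff_norm.2 <|
    (norm_sub_le_of_le (hC t ht) (hC c (mem_ball_self hR))).trans_eq (two_mul C).symm) hR

theorem norm_slope_sub_deriv_le {f : ℂ → ℂ} {c t : ℂ} {R C : ℝ}
    (hf : DifferentiableOn ℂ f (ball c R)) (hC : ∀ t ∈ ball c R, ‖f t‖ ≤ C) (ht : t ∈ ball c R)
    (hne : t ≠ c) :
    ‖slope f c t - deriv f c‖ ≤ 4 * C / R / R * ‖t - c‖ := by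
  have hR : 0 < R := pos_of_mem_ball ht
  have hc : c ∈ ball c R := mem_ball_self hR
  have hdslope (s : ℂ) (hs : s ∈ ball c R) : ‖dslope f c s‖ ≤ 2 * C / R :=
    Complex.norm_dslope_le_div_of_mapsTo_ball hf (fun t ht => mem_closedBall_iff_norm.2 <|
      (norm_sub_le_of_le (hC t ht) (hC c hc)).trans_eq (two_mul C).symm) hs
  have hdiff : DifferentiableOn ℂ (dslope f c) (ball c R) :=
    (Complex.differentiableOn_dslope (isOpen_ball.mem_nhds hc)).2 hf
  have hdist := Complex.dist_le_div_mul_dist_of_mapsTo_ball (R₂ := 4 * C / R) hdiff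
    (fun s hs => mem_closedBall_iff_norm.2 <|
      (norm_sub_le_of_le (hdslope s hs) (hdslope c hc)).trans_eq (by ring)) ht
  rwa [dist_eq_norm, dist_eq_norm, dslope_same, dslope_of_ne f hne] at hdist

variable {U V : Set ℂ} {F : ℂ → ℂ → ℂ}

theorem SepHolo.swap (h : SepHolo U V F) : SepHolo V U fun z t => F t z where
  left := h.right
  right := h.left
  locBdd z hz t ht := by
    obtain ⟨C, hC⟩ := h.locBdd t ht z hz
    exact ⟨C, eventually_swap_iff.1 hC⟩

theorem sepHolo_of_differentiableOn (hU : IsOpen U) (hV : IsOpen V)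
    (h : DifferentiableOn ℂ (fun p : ℂ × ℂ => F p.1 p.2) (U ×ˢ V)) : SepHolo U V F where
  left z hz := h.comp (f := fun t => (t, z)) (by fun_prop) fun _ ht => Set.mk_mem_prod ht hz
  right t ht := h.comp (f := fun z => (t, z)) (by fun_prop) fun _ hz => Set.mk_mem_prod ht hz
  locBdd t ht z hz := by
    have hcont := (h.continuousOn.continuousAt
      ((hU.prod hV).mem_nhds (Set.mk_mem_prod ht hz))).norm
    refine ⟨‖F t z‖ + 1, ?_⟩
    rw [← nhds_prod_eq]
    exact hcont.eventually_le_const (lt_add_one _)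

theorem SepHolo.exists_ball (hU : IsOpen U) (hV : IsOpen V) (h : SepHolo U V F) {t z : ℂ}
    (ht : t ∈ U) (hz : z ∈ V) :
    ∃ R > 0, ∃ C, ball t R ⊆ U ∧ ball z R ⊆ V ∧ ∀ s ∈ ball t R, ∀ w ∈ ball z R, ‖F s w‖ ≤ C := by
  obtain ⟨C, hC⟩ := h.locBdd t ht z hz
  have hmem : ∀ᶠ p : ℂ × ℂ in 𝓝 (t, z), (p.1 ∈ U ∧ p.2 ∈ V) ∧ ‖F p.1 p.2‖ ≤ C :=
    ((hU.prod hV).eventually_mem (Set.mk_mem_prod ht hz)).and (nhds_prod_eq (x := t) (y := z) ▸ hC)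
  obtain ⟨R, hR, hball⟩ := eventually_nhds_iff_ball.1 hmem
  rw [← ball_prod_same] at hball
  exact ⟨R, hR, C, fun s hs => (hball (s, z) ⟨hs, mem_ball_self hR⟩).1.1,
    fun w hw => (hball (t, w) ⟨mem_ball_self hR, hw⟩).1.2,
    fun s hs w hw => (hball (s, w) ⟨hs, hw⟩).2⟩

theorem SepHolo.tendstoLocallyUniformlyOn_slope (hU : IsOpen U) (hV : IsOpen V)
    (h : SepHolo U V F) {t : ℂ} (ht : t ∈ U) :
    TendstoLocallyUniformlyOn (fun s z => slope (fun r => F r z) t s) (dFst F t) (𝓝[≠] t) V := by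
  rw [Metric.tendstoLocallyUniformlyOn_iff]
  intro ε hε z hz
  obtain ⟨R, hR, C, hRU, hRV, hC⟩ := h.exists_ball hU hV ht hz
  have hlim : Tendsto (fun s => 4 * C / R / R * ‖s - t‖) (𝓝[≠] t) (𝓝 0) :=
    (Continuous.tendsto' (by fun_prop) t 0 (by simp)).mono_left nhdsWithin_le_nhds
  refine ⟨ball z R, mem_nhdsWithin_of_mem_nhds (ball_mem_nhds z hR), ?_⟩
  filter_upwards [hlim.eventually_lt_const hε, self_mem_nhdsWithin,
    mem_nhdsWithin_of_mem_nhds (ball_mem_nhds t hR)] with s hsε hne hs w hw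
  rw [dist_comm, dist_eq_norm]
  exact (norm_slope_sub_deriv_le ((h.left w (hRV hw)).mono hRU) (fun r hr => hC r hr w hw) hs
    hne).trans_lt hsε

theorem SepHolo.eventually_differentiableOn_slope (hU : IsOpen U) (h : SepHolo U V F) {t : ℂ}
    (ht : t ∈ U) :
    ∀ᶠ s in 𝓝[≠] t, DifferentiableOn ℂ (fun z => slope (fun r => F r z) t s) V := by
  filter_upwards [mem_nhdsWithin_of_mem_nhds (hU.mem_nhds ht)] with s hs
  simp only [slope_def_field]
  exact ((h.right s hs).fun_sub (h.right t ht)).div_const _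

theorem SepHolo.dFst (hU : IsOpen U) (hV : IsOpen V) (h : SepHolo U V F) :
    SepHolo U V (dFst F) where
  left z hz := (h.left z hz).deriv hU
  right t ht := (h.tendstoLocallyUniformlyOn_slope hU hV ht).differentiableOn
    (h.eventually_differentiableOn_slope hU ht) hV
  locBdd t ht z hz := by
    obtain ⟨R, hR, C, hRU, hRV, hC⟩ := h.exists_ball hU hV ht hz
    refine ⟨2 * C / (R / 2), ?_⟩
    filter_upwards [prod_mem_prod (ball_mem_nhds t (half_pos hR)) (ball_mem_nhds z hR)]
      with p hp
    have hsub : ball p.1 (R / 2) ⊆ ball t R := by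
      refine ball_subset_ball' ?_
      have := mem_ball.1 hp.1
      linarith
    exact norm_deriv_le_of_norm_le (half_pos hR) ((h.left p.2 (hRV hp.2)).mono (hsub.trans hRU))
      fun s hs => hC s (hsub hs) p.2 hp.2

theorem SepHolo.dSnd (hU : IsOpen U) (hV : IsOpen V) (h : SepHolo U V F) :
    SepHolo U V (dSnd F) :=
  (h.swap.dFst hV hU).swap

theorem SepHolo.hasDerivAt_dSnd (hU : IsOpen U) (hV : IsOpen V) (h : SepHolo U V F) {t z : ℂ}
    (ht : t ∈ U) (hz : z ∈ V) :
    HasDerivAt (fun s => JacobiHecke.dSnd F s z) (JacobiHecke.dSnd (JacobiHecke.dFst F) t z) t := by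
  have hlim := ((h.tendstoLocallyUniformlyOn_slope hU hV ht).deriv
    (h.eventually_differentiableOn_slope hU ht) hV).tendsto_at hz
  refine hasDerivAt_iff_tendsto_slope.2 (hlim.congr' ?_)
  filter_upwards [mem_nhdsWithin_of_mem_nhds (hU.mem_nhds ht)] with s hs
  have hdiff (r : ℂ) (hr : r ∈ U) : DifferentiableAt ℂ (F r) z :=
    (h.right r hr).differentiableAt (hV.mem_nhds hz)
  simp only [Function.comp_apply, slope_def_field, JacobiHecke.dSnd]
  rw [deriv_div_const, deriv_fun_sub (hdiff s hs) (hdiff t ht)]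

theorem SepHolo.hasDerivAt_iteratedDeriv (hU : IsOpen U) (hV : IsOpen V) (h : SepHolo U V F)
    (a : ℕ) {t z : ℂ} (ht : t ∈ U) (hz : z ∈ V) :
    HasDerivAt (fun s => iteratedDeriv a (F s) z) (iteratedDeriv a (JacobiHecke.dFst F t) z) t := by
  induction a generalizing F with
  | zero =>
    simp only [iteratedDeriv_zero]
    exact ((h.left z hz).differentiableAt (hU.mem_nhds ht)).hasDerivAt
  | succ a ih =>
    have hcomm : JacobiHecke.dFst (JacobiHecke.dSnd F) t =ᶠ[𝓝 z] deriv (JacobiHecke.dFst F t) := by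
      filter_upwards [hV.mem_nhds hz] with w hw
      exact (h.hasDerivAt_dSnd hU hV ht hw).deriv
    simp only [iteratedDeriv_succ']
    rw [← hcomm.iteratedDeriv_eq]
    exact ih (h.dSnd hU hV)

theorem SepHolo.iteratedDeriv_comm (hU : IsOpen U) (hV : IsOpen V) (h : SepHolo U V F) (a b : ℕ)
    {t z : ℂ} (ht : t ∈ U) (hz : z ∈ V) :
    iteratedDeriv a (fun w => iteratedDeriv b (fun s => F s w) t) z =
      iteratedDeriv b (fun s => iteratedDeriv a (F s) z) t := by
  induction b generalizing F with
  | zero => simp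
  | succ b ih =>
    have hderiv : deriv (fun s => iteratedDeriv a (F s) z) =ᶠ[𝓝 t]
        fun s => iteratedDeriv a (JacobiHecke.dFst F s) z := by
      filter_upwards [hU.mem_nhds ht] with s hs
      exact (h.hasDerivAt_iteratedDeriv hU hV a hs hz).deriv
    simp only [iteratedDeriv_succ' (n := b)]
    rw [hderiv.iteratedDeriv_eq]
    exact ih (h.dFst hU hV)

end TwoVariables

section Cusp

open Filter Topology Metric Derivative
open scoped Manifold

/-- The functions on `ℍ` that are holomorphic and bounded as `Im τ → ∞`. -/
def holoBdd : Submodule ℂ (ℍ → ℂ) where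
  carrier := {f | MDiff f ∧ IsBoundedAtImInfty f}
  zero_mem' := ⟨mdifferentiable_const, zero_form_isBoundedAtImInfty⟩
  add_mem' hf hg := ⟨hf.1.add hg.1, hf.2.add hg.2⟩
  smul_mem' c _ hf := ⟨hf.1.const_smul c, hf.2.smul c⟩

theorem ball_subset_im_lt {t : ℂ} {R A : ℝ} (ht : A + R ≤ t.im) : ball t R ⊆ {s | A < s.im} := by
  intro s hs
  have him := (Complex.abs_im_le_norm (s - t)).trans_lt (mem_ball_iff_norm.1 hs)
  rw [Complex.sub_im] at him
  have := (abs_lt.1 him).1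
  simp only [Set.mem_ofPred_eq]
  linarith

theorem normalizedDeriv_mem_holoBdd {f : ℍ → ℂ} (hf : f ∈ holoBdd) : D f ∈ holoBdd := by
  refine ⟨normalizedDerivOfComplex_mdifferentiable hf.1, ?_⟩
  obtain ⟨C, A, hC⟩ := isBoundedAtImInfty_iff.1 hf.2
  refine isBoundedAtImInfty_iff.2
    ⟨‖(2 * Real.pi * Complex.I : ℂ)⁻¹‖ * (2 * C / 1), max A 0 + 1, fun τ hτ => ?_⟩
  have hball : ball (τ : ℂ) 1 ⊆ {s | max A 0 < s.im} := ball_subset_im_lt hτ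
  have hpos {s : ℂ} (hs : s ∈ ball (τ : ℂ) 1) : 0 < s.im := (le_max_right _ _).trans_lt (hball hs)
  rw [normalizedDerivOfComplex, norm_mul]
  gcongr
  refine norm_deriv_le_of_norm_le one_pos
    ((UpperHalfPlane.mdifferentiable_iff.1 hf.1).mono fun s hs => hpos hs) fun s hs => ?_
  rw [Function.comp_apply, ofComplex_apply_of_im_pos (hpos hs)]
  exact hC _ ((le_max_left _ _).trans (hball hs).le)

/-- The maximum principle on the disc to which the cusp function extends. -/
theorem norm_le_of_periodic {f : ℍ → ℂ} (hf : f ∈ holoBdd)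
    (hper : Function.Periodic (f ∘ ofComplex) 1) {y C : ℝ} (hy : 0 < y)
    (hC : ∀ τ : ℍ, τ.im = y → ‖f τ‖ ≤ C) {τ : ℍ} (hτ : y ≤ τ.im) : ‖f τ‖ ≤ C := by
  have hper' : Function.Periodic (f ∘ ofComplex) ((1 : ℝ) : ℂ) := by simpa using hper
  have hdiff := differentiableOn_cuspFunction_ball one_pos hper' hf.1 hf.2
  have hnorm (s : ℂ) : ‖Function.Periodic.qParam 1 s‖ = Real.exp (-2 * Real.pi * s.im) := by
    rw [Function.Periodic.norm_qParam, div_one]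
  have hr : Real.exp (-2 * Real.pi * y) < 1 := Real.exp_lt_one_iff.2 (by nlinarith [Real.pi_pos])
  have hr0 : Real.exp (-2 * Real.pi * y) ≠ 0 := (Real.exp_pos _).ne'
  rw [← eq_cuspFunction τ one_ne_zero hper']
  refine Complex.norm_le_of_forall_mem_frontier_norm_le
    (U := ball 0 (Real.exp (-2 * Real.pi * y))) isBounded_ball ?_ (fun q hq => ?_) ?_
  · refine DifferentiableOn.diffContOnCl (hdiff.mono ?_)
    rw [closure_ball _ hr0]
    exact closedBall_subset_ball hr
  · rw [frontier_ball _ hr0, mem_sphere_zero_iff_norm] at hq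
    obtain ⟨s, rfl⟩ : ∃ s, Function.Periodic.qParam 1 s = q :=
      ⟨_, Function.Periodic.qParam_right_inv one_ne_zero (norm_ne_zero_iff.1 (hq ▸ hr0))⟩
    rw [hnorm, Real.exp_eq_exp] at hq
    have hs : s.im = y := mul_left_cancel₀ (by simp [Real.pi_ne_zero]) hq
    have hτs := eq_cuspFunction ⟨s, hs ▸ hy⟩ one_ne_zero hper'
    simp only at hτs
    rw [hτs]
    exact hC _ hs
  · rw [closure_ball _ hr0, mem_closedBall_zero_iff, hnorm, Real.exp_le_exp]
    have := Real.pi_pos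
    rw [coe_im]
    nlinarith

/-- Holomorphic functions on `ℍ × ℂ` that are periodic in the first variable, and bounded in it
at `i∞` for every rational value of the second one. -/
structure CuspBdd (F : ℂ → ℂ → ℂ) : Prop where
  sepHolo : SepHolo upperHalfPlaneSet Set.univ F
  periodic : ∀ t z, 0 < t.im → F (t + 1) z = F t z
  bdd : ∀ y : ℚ, IsBoundedAtImInfty fun τ : ℍ => F τ y

theorem exists_forall_norm_le_of_isCompact {X E : Type*} [TopologicalSpace X] [Norm E]
    {f : X → E} {K : Set X} (hK : IsCompact K)
    (hf : ∀ x ∈ K, ∃ C, ∀ᶠ y in 𝓝 x, ‖f y‖ ≤ C) : ∃ C, ∀ x ∈ K, ‖f x‖ ≤ C := by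
  refine hK.induction_on (p := fun s => ∃ C, ∀ x ∈ s, ‖f x‖ ≤ C) ⟨0, by simp⟩
    (fun s t hst ⟨C, hC⟩ => ⟨C, fun x hx => hC x (hst hx)⟩) ?_ fun x hx => ?_
  · rintro s t ⟨C, hC⟩ ⟨C', hC'⟩
    exact ⟨max C C', fun x hx => hx.elim (fun h => (hC x h).trans (le_max_left _ _))
      fun h => (hC' x h).trans (le_max_right _ _)⟩
  · obtain ⟨C, hC⟩ := hf x hx
    exact ⟨_, mem_nhdsWithin_of_mem_nhds hC, C, fun y hy => hy⟩

theorem periodic_comp_ofComplex {f : ℂ → ℂ} (hf : ∀ t : ℂ, 0 < t.im → f (t + 1) = f t) :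
    Function.Periodic ((fun τ : ℍ => f τ) ∘ ofComplex) 1 := by
  intro t
  rcases lt_or_ge 0 t.im with ht | ht
  · have ht' : 0 < (t + 1).im := by simpa using ht
    simp only [Function.comp_apply, coe_ofComplex ht, coe_ofComplex ht', hf t ht]
  · have ht' : (t + 1).im ≤ 0 := by simpa using ht
    simp only [Function.comp_apply, ofComplex_apply_of_im_nonpos ht,
      ofComplex_apply_of_im_nonpos ht']

theorem SepHolo.exists_norm_le_of_periodic {F : ℂ → ℂ → ℂ}
    (hF : SepHolo upperHalfPlaneSet Set.univ F)
    (hper : ∀ t z : ℂ, 0 < t.im → F (t + 1) z = F t z) {y : ℝ} (hy : 0 < y) {K : Set ℂ}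
    (hK : IsCompact K) : ∃ B, ∀ t : ℂ, t.im = y → ∀ z ∈ K, ‖F t z‖ ≤ B := by
  obtain ⟨B, hB⟩ := exists_forall_norm_le_of_isCompact (f := fun p : ℂ × ℂ => F p.1 p.2)
    ((isCompact_Icc.reProdIm isCompact_singleton).prod hK :
      IsCompact ((Set.Icc (0 : ℝ) 1 ×ℂ {y}) ×ˢ K)) fun p hp => by
      rw [nhds_prod_eq]
      exact hF.locBdd p.1 (show 0 < p.1.im from hp.1.2 ▸ hy) p.2 (Set.mem_univ _)
  refine ⟨B, fun t ht z hz => ?_⟩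
  have hshift := (periodic_comp_ofComplex (f := (F · z)) (hper · z)).sub_int_mul_eq (x := t) ⌊t.re⌋
  simp only [Function.comp_apply, mul_one] at hshift
  rw [coe_ofComplex (by simpa [ht]), coe_ofComplex (by simpa [ht])] at hshift
  rw [← hshift]
  refine hB (_, z) ⟨⟨?_, by simp [ht]⟩, hz⟩
  simpa using (Int.fract_lt_one t.re).le

theorem frequently_mem_range_ratCast (x : ℚ) :
    ∃ᶠ y in 𝓝[≠] (x : ℂ), y ∈ Set.range (Rat.cast : ℚ → ℂ) := by
  have hlim : Tendsto (fun n : ℕ => (x : ℂ) + 1 / ((n : ℂ) + 1)) atTop (𝓝[≠] (x : ℂ)) := by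
    refine tendsto_nhdsWithin_iff.2 ⟨?_, Eventually.of_forall fun n => ?_⟩
    · simpa using (tendsto_one_div_add_atTop_nhds_zero_nat (𝕜 := ℂ)).const_add (x : ℂ)
    · simpa using Nat.cast_add_one_ne_zero (R := ℂ) n
  exact hlim.frequently (Frequently.of_forall fun n => ⟨x + 1 / (n + 1), by push_cast; rfl⟩)

namespace CuspBdd

variable {F : ℂ → ℂ → ℂ} (h : CuspBdd F)
include h

theorem mem_holoBdd (y : ℚ) : (fun τ : ℍ => F τ y) ∈ holoBdd := by
  refine ⟨UpperHalfPlane.mdifferentiable_iff.2 ?_, h.bdd y⟩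
  exact (h.sepHolo.left y (Set.mem_univ _)).congr fun t ht => by
    rw [Function.comp_apply, coe_ofComplex ht]

/-- On the line `Im t = 1` the difference is controlled by the derivative in the second variable,
and the maximum principle propagates the estimate upwards. -/
theorem norm_sub_le {x y : ℚ} {B : ℝ}
    (hB : ∀ t : ℂ, t.im = 1 → ∀ z ∈ closedBall (x : ℂ) 1, ‖JacobiHecke.dSnd F t z‖ ≤ B)
    (hy : (y : ℂ) ∈ closedBall (x : ℂ) 1) {τ : ℍ} (hτ : 1 ≤ τ.im) :
    ‖F τ y - F τ x‖ ≤ B * ‖(y : ℂ) - x‖ := by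
  refine norm_le_of_periodic (f := (fun τ : ℍ => F τ y) - fun τ : ℍ => F τ x)
    (sub_mem (h.mem_holoBdd y) (h.mem_holoBdd x))
    ((periodic_comp_ofComplex (f := (F · y)) (h.periodic · y)).sub
      (periodic_comp_ofComplex (f := (F · x)) (h.periodic · x))) one_pos (fun τ hτ => ?_) hτ
  exact (convex_closedBall (x : ℂ) 1).norm_image_sub_le_of_norm_deriv_le
    (fun z _ => (h.sepHolo.right τ τ.im_pos).differentiableAt univ_mem) (hB τ hτ)
    (mem_closedBall_self zero_le_one) hy

theorem dSnd : CuspBdd (dSnd F) := by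
  have hsep := h.sepHolo.dSnd isOpen_upperHalfPlaneSet isOpen_univ
  have hper (t z : ℂ) (ht : 0 < t.im) : JacobiHecke.dSnd F (t + 1) z = JacobiHecke.dSnd F t z :=
    congrArg (deriv · z) (funext fun w => h.periodic t w ht)
  refine ⟨hsep, hper, fun x => ?_⟩
  obtain ⟨B, hB⟩ := hsep.exists_norm_le_of_periodic hper one_pos
    (isCompact_closedBall (x : ℂ) 1)
  refine isBoundedAtImInfty_iff.2 ⟨B, 1, fun τ hτ => ?_⟩
  have hderiv : HasDerivAt (F τ) (JacobiHecke.dSnd F τ x) x :=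
    ((h.sepHolo.right τ τ.im_pos).differentiableAt univ_mem).hasDerivAt
  refine le_of_tendsto_of_frequently (hasDerivAt_iff_tendsto_slope.1 hderiv).norm ?_
  have hnear : ∀ᶠ y in 𝓝[≠] (x : ℂ), y ∈ closedBall (x : ℂ) 1 :=
    mem_nhdsWithin_of_mem_nhds (closedBall_mem_nhds _ one_pos)
  refine ((frequently_mem_range_ratCast x).and_eventually
    (hnear.and self_mem_nhdsWithin)).mono ?_
  rintro _ ⟨⟨y, rfl⟩, hy, hne⟩
  rw [slope_def_field, norm_div, div_le_iff₀ (norm_pos_iff.2 (sub_ne_zero.2 hne))]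
  exact h.norm_sub_le hB hy hτ

theorem isBoundedAtImInfty_iteratedDeriv (a : ℕ) (y : ℚ) :
    IsBoundedAtImInfty fun τ : ℍ => iteratedDeriv a (F τ) y := by
  induction a generalizing F with
  | zero => exact h.bdd y
  | succ a ih =>
    simp only [iteratedDeriv_succ']
    exact ih h.dSnd

end CuspBdd

end Cusp

section HeatOperator

open Derivative Finset
open scoped Manifold

theorem normalizedDeriv_sum {ι : Type*} {s : Finset ι} {f : ι → ℍ → ℂ}
    (hf : ∀ i ∈ s, MDiff (f i)) : D (∑ i ∈ s, f i) = ∑ i ∈ s, D (f i) := by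
  induction s using Finset.cons_induction with
  | empty => exact normalizedDerivOfComplex_const 0
  | cons i s hi ih =>
    have hs : ∀ j ∈ s, MDiff (f j) := fun j hj => hf j (mem_cons_of_mem hj)
    have hsum : MDiff (∑ j ∈ s, f j) :=
      sum_induction _ _ (fun _ _ => MDifferentiable.add) mdifferentiable_const hs
    rw [sum_cons, sum_cons, normalizedDerivOfComplex_add _ _ (hf i (mem_cons_self i s)) hsum, ih hs]

theorem iterate_normalizedDeriv_mdifferentiable {f : ℍ → ℂ} (hf : MDiff f) (n : ℕ) :
    MDiff (D^[n] f) := by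
  induction n with
  | zero => exact hf
  | succ n ih =>
    rw [Function.iterate_succ_apply']
    exact normalizedDerivOfComplex_mdifferentiable ih

theorem iterate_normalizedDeriv_smul_sub_smul {f g : ℍ → ℂ} (hf : MDiff f) (hg : MDiff g)
    (a b : ℂ) (n : ℕ) : D^[n] (a • f - b • g) = a • D^[n] f - b • D^[n] g := by
  induction n with
  | zero => rfl
  | succ n ih =>
    have hf' := iterate_normalizedDeriv_mdifferentiable hf n
    have hg' := iterate_normalizedDeriv_mdifferentiable hg n
    simp only [Function.iterate_succ_apply', ih]
    rw [normalizedDerivOfComplex_sub _ _ (hf'.const_smul a) (hg'.const_smul b),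
      normalizedDerivOfComplex_smul _ _ hf', normalizedDerivOfComplex_smul _ _ hg']

/-- The heat operator in weight `w` and index `m`, on the sequence `h` of the Taylor coefficients
of even order (or of those of odd order) of a function on `ℍ × ℂ`. -/
def heat (w : ℤ) (m : ℂ) (h : ℕ → ℍ → ℂ) (j : ℕ) : ℍ → ℂ :=
  m • D (h j) - ((j + 1 : ℂ) * (j + w)) • h (j + 1)

/-- The composition of the heat operators of the weights `w, w + 2, …, w + 2ν - 2`. -/
def heatIter (w : ℤ) (m : ℂ) : ℕ → (ℕ → ℍ → ℂ) → ℕ → ℍ → ℂ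
  | 0, h => h
  | ν + 1, h => heatIter (w + 2) m ν (heat w m h)

variable {w : ℤ} {m : ℂ} {h : ℕ → ℍ → ℂ}

theorem heat_mdifferentiable (hh : ∀ j, MDiff (h j)) (j : ℕ) : MDiff (heat w m h j) :=
  ((normalizedDerivOfComplex_mdifferentiable (hh j)).const_smul m).sub ((hh (j + 1)).const_smul _)

theorem heatIter_sum {ι : Type*} {s : Finset ι} {h : ι → ℕ → ℍ → ℂ}
    (hh : ∀ i ∈ s, ∀ j, MDiff (h i j)) (ν : ℕ) :
    heatIter w m ν (∑ i ∈ s, h i) = ∑ i ∈ s, heatIter w m ν (h i) := by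
  induction ν generalizing w h with
  | zero => rfl
  | succ ν ih =>
    have hheat : heat w m (∑ i ∈ s, h i) = ∑ i ∈ s, heat w m (h i) := by
      ext1 j
      simp only [heat, Finset.sum_apply, normalizedDeriv_sum fun i hi => hh i hi j, smul_sum,
        sum_sub_distrib]
    rw [heatIter, hheat, ih fun i hi => heat_mdifferentiable (hh i hi)]
    rfl

theorem heatIter_mem_holoBdd (hh : ∀ j, h j ∈ holoBdd) (ν j : ℕ) :
    heatIter w m ν h j ∈ holoBdd := by
  induction ν generalizing w h with
  | zero => exact hh j
  | succ _ ih =>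
    exact ih fun j => sub_mem (holoBdd.smul_mem _ (normalizedDeriv_mem_holoBdd (hh j)))
      (holoBdd.smul_mem _ (hh (j + 1)))

theorem factorialQuotient_succ (x : ℤ) (n : ℕ) :
    factorialQuotient x (n + 1) = factorialQuotient x n * (x + 1 + n) :=
  prod_range_succ _ _

theorem factorialQuotient_succ' (x : ℤ) (n : ℕ) :
    factorialQuotient x (n + 1) = (x + 1) * factorialQuotient (x + 1) n := by
  simp only [factorialQuotient, prod_range_succ', Nat.cast_zero, add_zero, mul_comm]
  congr 1
  refine prod_congr rfl fun i _ => ?_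
  push_cast
  ring

theorem add_mul_factorialQuotient_succ (w : ℤ) (μ q : ℕ) :
    ((μ + q + 1 : ℂ)) * factorialQuotient (w + μ + q - 1) (q + 1) =
      μ * factorialQuotient (w + μ + q) (q + 1) +
        (q + 1) * (q + w) * factorialQuotient (w + μ + q) q := by
  rw [factorialQuotient_succ', factorialQuotient_succ, sub_add_cancel]
  push_cast
  ring

/-- The recursion, in `ν`, for the coefficients of `heatIter w m ν` at the index `0`: the two
summands come from the two terms of the innermost heat operator. -/
theorem heatIter_coeff_succ (w : ℤ) (m : ℂ) {ν μ q : ℕ} (h : μ + q = ν + 1) :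
    (-1) ^ q * m ^ μ * ν.factorial / μ.factorial * μ * factorialQuotient (w + ν) q +
        (-1) ^ q * m ^ μ * ν.factorial / μ.factorial * (q * (q - 1 + w)) *
          factorialQuotient (w + ν) (q - 1) =
      (-1) ^ q * m ^ μ * (ν + 1).factorial / μ.factorial *
        factorialQuotient (w + (ν + 1 : ℕ) - 2) q := by
  rcases q with _ | q
  · obtain rfl : μ = ν + 1 := h
    simp only [factorialQuotient, Nat.factorial_succ, prod_range_zero]
    push_cast
    ring
  · obtain rfl : ν = μ + q := by lia
    have hrec := add_mul_factorialQuotient_succ w μ q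
    rw [show w + ((μ + q + 1 : ℕ) : ℤ) - 2 = w + μ + q - 1 by push_cast; ring,
      Nat.factorial_succ, Nat.add_sub_cancel,
      show w + ((μ + q : ℕ) : ℤ) = w + μ + q by push_cast; ring]
    push_cast
    linear_combination (-1) ^ q * m ^ μ * (μ + q).factorial / μ.factorial * hrec

theorem heatIter_zero_eq_sum (hh : ∀ j, MDiff (h j)) (ν : ℕ) :
    heatIter w m ν h 0 = ∑ p ∈ antidiagonal ν,
      ((-1) ^ p.2 * m ^ p.1 * ν.factorial / p.1.factorial *
        factorialQuotient (w + ν - 2) p.2) • D^[p.1] (h p.2) := by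
  induction ν generalizing w h with
  | zero => simp [heatIter, factorialQuotient]
  | succ ν ih =>
    let f (p : ℕ × ℕ) : ℍ → ℂ := ((-1) ^ p.2 * m ^ p.1 * ν.factorial / p.1.factorial * p.1 *
      factorialQuotient (w + ν) p.2) • D^[p.1] (h p.2)
    let g (p : ℕ × ℕ) : ℍ → ℂ := ((-1) ^ p.2 * m ^ p.1 * ν.factorial / p.1.factorial *
      (p.2 * (p.2 - 1 + w)) * factorialQuotient (w + ν) (p.2 - 1)) • D^[p.1] (h p.2)
    have hf : ∑ p ∈ antidiagonal (ν + 1), f p = ∑ p ∈ antidiagonal ν, f (p.1 + 1, p.2) := by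
      simp [Nat.sum_antidiagonal_succ, f]
    have hg : ∑ p ∈ antidiagonal (ν + 1), g p = ∑ p ∈ antidiagonal ν, g (p.1, p.2 + 1) := by
      simp [Nat.sum_antidiagonal_succ', g]
    trans ∑ p ∈ antidiagonal (ν + 1), (f p + g p)
    · rw [sum_add_distrib, hf, hg, ← sum_add_distrib, heatIter, ih (heat_mdifferentiable hh)]
      refine sum_congr rfl fun p _ => ?_
      have hfac : (p.1.factorial : ℂ) ≠ 0 := Nat.cast_ne_zero.2 p.1.factorial_ne_zero
      have hp : (p.1 + 1 : ℂ) ≠ 0 := Nat.cast_add_one_ne_zero p.1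
      simp only [heat, f, g]
      rw [iterate_normalizedDeriv_smul_sub_smul
        (normalizedDerivOfComplex_mdifferentiable (hh p.2)) (hh (p.2 + 1)),
        ← Function.iterate_succ_apply, show w + 2 + ν - 2 = w + ν by ring, smul_sub, smul_smul,
        smul_smul, sub_eq_add_neg, ← neg_smul (M := ℍ → ℂ), Nat.factorial_succ, Nat.add_sub_cancel]
      congr 2
      · push_cast
        field_simp
        ring
      · push_cast
        ring
    · refine sum_congr rfl fun p hp => ?_
      simp only [f, g, ← add_smul]
      rw [heatIter_coeff_succ w m (HasAntidiagonal.mem_antidiagonal.1 hp)]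

end HeatOperator

section Equivariance

open Derivative Finset
open scoped Manifold

variable {w : ℤ} {m : ℂ} {g : GL (Fin 2) ℝ} {h : ℕ → ℍ → ℂ}

theorem smul_slash_of_det_pos (hg : 0 < g.det.val) (κ : ℤ) (c : ℂ) (f : ℍ → ℂ) :
    (c • f) ∣[κ] g = c • (f ∣[κ] g) := by
  rw [ModularForm.smul_slash, σ, if_pos hg]
  rfl

/-- The function `-m det(g) c / (2πi (cτ + d))`, whose exponential generating series
`∑ Xⁱ / i!` describes the even Taylor coefficients of the Gaussian factor in the action of `g` on
functions on `ℍ × ℂ` of scalar index `m`. -/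
def gaussCoeff (m : ℂ) (g : GL (Fin 2) ℝ) (τ : ℍ) : ℂ :=
  -(m * g.det.val) * ((2 * Real.pi * Complex.I)⁻¹ * (g 1 0 / denom g τ))

/-- The action of `g` on sequences of Taylor coefficients in weight `w` and scalar index `m`. -/
def seqSlash (w : ℤ) (m : ℂ) (g : GL (Fin 2) ℝ) (h : ℕ → ℍ → ℂ) (j : ℕ) : ℍ → ℂ :=
  ∑ p ∈ antidiagonal j,
    (p.1.factorial : ℂ)⁻¹ • (gaussCoeff m g ^ p.1 * (h p.2 ∣[w + 2 * (p.2 : ℤ)] g))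

theorem gaussCoeff_eq_smul_slash (m : ℂ) (g : GL (Fin 2) ℝ) :
    gaussCoeff m g =
      (-(m * g.det.val) * ((2 * Real.pi * Complex.I)⁻¹ * g 1 0)) • ((1 : ℍ → ℂ) ∣[(1 : ℤ)] g) := by
  ext τ
  simp only [gaussCoeff, Pi.smul_apply, ModularForm.slash_apply, Pi.one_apply, map_one, sub_self,
    zpow_zero, _root_.zpow_neg_one, smul_eq_mul]
  ring

theorem gaussCoeff_mdifferentiable (m : ℂ) (g : GL (Fin 2) ℝ) : MDiff (gaussCoeff m g) := by
  rw [gaussCoeff_eq_smul_slash]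
  have h1 : MDiff (1 : ℍ → ℂ) := mdifferentiable_const
  exact (h1.slash 1 g).const_smul _

theorem smul_normalizedDeriv_gaussCoeff (m : ℂ) (hg : 0 < g.det.val) :
    (m * g.det.val : ℂ) • D (gaussCoeff m g) = gaussCoeff m g ^ 2 := by
  have h1 : MDiff (1 : ℍ → ℂ) := mdifferentiable_const
  have hD : D (1 : ℍ → ℂ) = 0 := normalizedDerivOfComplex_const 1
  rw [gaussCoeff_eq_smul_slash, normalizedDerivOfComplex_smul _ _ (h1.slash 1 g),
    normalizedDerivOfComplex_slash h1 hg, hD, SlashAction.zero_slash]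
  ext τ
  simp [ModularForm.slash_apply, -neg_mul]
  ring

theorem smul_normalizedDeriv_gaussCoeff_pow (m : ℂ) (hg : 0 < g.det.val) (i : ℕ) :
    (m * g.det.val : ℂ) • D (gaussCoeff m g ^ i) = (i : ℂ) • gaussCoeff m g ^ (i + 1) := by
  rw [normalizedDerivOfComplex_pow _ _ (gaussCoeff_mdifferentiable m g), ← mul_smul_comm,
    smul_normalizedDeriv_gaussCoeff m hg]
  rcases i with _ | i
  · simp
  · ext τ
    simp only [Pi.mul_apply, Pi.pow_apply, Pi.smul_apply, Pi.natCast_apply, smul_eq_mul,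
      Nat.add_sub_cancel]
    ring

theorem smul_normalizedDeriv_slash (m : ℂ) (hg : 0 < g.det.val) {f : ℍ → ℂ} (hf : MDiff f) :
    (m * g.det.val : ℂ) • D (f ∣[w] g) =
      (w : ℂ) • (gaussCoeff m g * (f ∣[w] g)) + m • (D f ∣[w + 2] g) := by
  have hdet : (g.det.val : ℂ) ≠ 0 := Complex.ofReal_ne_zero.2 hg.ne'
  rw [normalizedDerivOfComplex_slash hf hg]
  ext τ
  simp only [gaussCoeff, Pi.smul_apply, Pi.add_apply, Pi.mul_apply, smul_eq_mul,
    ← GeneralLinearGroup.val_det_apply]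
  field_simp
  ring

theorem smul_normalizedDeriv_gaussCoeff_pow_mul_slash (m : ℂ) (hg : 0 < g.det.val) {f : ℍ → ℂ}
    (hf : MDiff f) (i : ℕ) :
    (m * g.det.val : ℂ) • D (gaussCoeff m g ^ i * (f ∣[w] g)) =
      (i + w : ℂ) • (gaussCoeff m g ^ (i + 1) * (f ∣[w] g)) +
        m • (gaussCoeff m g ^ i * (D f ∣[w + 2] g)) := by
  rw [normalizedDerivOfComplex_mul _ _ ((gaussCoeff_mdifferentiable m g).pow i) (hf.slash w g),
    smul_add, ← smul_mul_assoc, ← mul_smul_comm, smul_normalizedDeriv_gaussCoeff_pow m hg,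
    smul_normalizedDeriv_slash m hg hf, pow_succ]
  simp only [smul_mul_assoc, mul_add, mul_smul_comm, add_smul, mul_assoc]
  abel

theorem smul_normalizedDeriv_seqSlash (hg : 0 < g.det.val) (hh : ∀ j, MDiff (h j)) (j : ℕ) :
    (m * g.det.val : ℂ) • D (seqSlash w m g h j) =
      ∑ p ∈ antidiagonal j, ((p.1.factorial : ℂ)⁻¹ * (p.1 + w + 2 * p.2)) •
          (gaussCoeff m g ^ (p.1 + 1) * (h p.2 ∣[w + 2 * (p.2 : ℤ)] g)) +
        ∑ p ∈ antidiagonal j, (p.1.factorial : ℂ)⁻¹ •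
          m • (gaussCoeff m g ^ p.1 * (D (h p.2) ∣[w + 2 * (p.2 : ℤ) + 2] g)) := by
  have hdiff (p : ℕ × ℕ) : MDiff (gaussCoeff m g ^ p.1 * (h p.2 ∣[w + 2 * (p.2 : ℤ)] g)) :=
    ((gaussCoeff_mdifferentiable m g).pow p.1).mul ((hh p.2).slash _ g)
  rw [seqSlash, normalizedDeriv_sum fun p _ => (hdiff p).const_smul _, smul_sum,
    ← sum_add_distrib]
  refine sum_congr rfl fun p _ => ?_
  rw [normalizedDerivOfComplex_smul _ _ (hdiff p), smul_comm,
    smul_normalizedDeriv_gaussCoeff_pow_mul_slash m hg (hh p.2), smul_add, smul_smul]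
  push_cast
  rw [← add_assoc (p.1 : ℂ)]

theorem smul_sum_antidiagonal_succ {V : Type*} [AddCommGroup V] [Module ℂ V] (w : ℂ) (j : ℕ)
    (T : ℕ → ℕ → V) :
    ((j + 1) * (j + w)) • ∑ p ∈ antidiagonal (j + 1), (p.1.factorial : ℂ)⁻¹ • T p.1 p.2 =
      ∑ p ∈ antidiagonal j,
          ((p.1.factorial : ℂ)⁻¹ * (p.1 + w + 2 * p.2)) • T (p.1 + 1) p.2 +
        ∑ p ∈ antidiagonal j,
          ((p.1.factorial : ℂ)⁻¹ * ((p.2 + 1) * (p.2 + w))) • T p.1 (p.2 + 1) := by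
  let f (p : ℕ × ℕ) : V :=
    ((p.1.factorial : ℂ)⁻¹ * (p.1 * (p.1 - 1 + w + 2 * p.2))) • T p.1 p.2
  let g (p : ℕ × ℕ) : V := ((p.1.factorial : ℂ)⁻¹ * (p.2 * (p.2 - 1 + w))) • T p.1 p.2
  trans ∑ p ∈ antidiagonal (j + 1), f p + ∑ p ∈ antidiagonal (j + 1), g p
  · rw [smul_sum, ← sum_add_distrib]
    refine sum_congr rfl fun p hp => ?_
    have hj : (j : ℂ) = p.1 + p.2 - 1 :=
      eq_sub_of_add_eq (by exact_mod_cast (HasAntidiagonal.mem_antidiagonal.1 hp).symm)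
    simp only [f, g, smul_smul, ← add_smul, hj]
    congr 1
    ring
  · simp only [Nat.sum_antidiagonal_succ (f := f), Nat.sum_antidiagonal_succ' (f := g)]
    congr 1
    · have hfac (p : ℕ × ℕ) : (p.1.factorial : ℂ)⁻¹ =
          ((p.1 + 1).factorial : ℂ)⁻¹ * (p.1 + 1 : ℕ) := by
        have hp := Nat.cast_ne_zero (R := ℂ).2 p.1.factorial_ne_zero
        have hp' : ((p.1 + 1 : ℕ) : ℂ) ≠ 0 := Nat.cast_ne_zero.2 p.1.succ_ne_zero
        rw [Nat.factorial_succ, Nat.cast_mul]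
        field_simp
      rw [show f (0, j + 1) = 0 by simp [f], zero_add]
      refine sum_congr rfl fun p _ => ?_
      simp only [f]
      rw [hfac p]
      push_cast
      ring_nf
    · simp [g]

theorem heat_seqSlash (hg : 0 < g.det.val) (hh : ∀ j, MDiff (h j)) :
    heat w (m * g.det.val) (seqSlash w m g h) = seqSlash (w + 2) m g (heat w m h) := by
  ext1 j
  have hslash (p : ℕ) : heat w m h p ∣[w + 2 + 2 * (p : ℤ)] g =
      m • (D (h p) ∣[w + 2 * (p : ℤ) + 2] g) -
        ((p + 1 : ℂ) * (p + w)) • (h (p + 1) ∣[w + 2 * ((p + 1 : ℕ) : ℤ)] g) := by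
    rw [heat, sub_eq_add_neg, SlashAction.add_slash, SlashAction.neg_slash,
      smul_slash_of_det_pos hg, smul_slash_of_det_pos hg, ← sub_eq_add_neg]
    push_cast
    ring_nf
  rw [heat, smul_normalizedDeriv_seqSlash hg hh, seqSlash,
    smul_sum_antidiagonal_succ (w : ℂ) j fun i p => gaussCoeff m g ^ i * (h p ∣[w + 2 * (p : ℤ)] g),
    add_sub_add_left_eq_sub, ← sum_sub_distrib]
  refine sum_congr rfl fun p _ => ?_
  rw [hslash, mul_sub, smul_sub, mul_smul_comm, mul_smul_comm, ← smul_smul]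

theorem seqSlash_mdifferentiable (hh : ∀ j, MDiff (h j)) (j : ℕ) :
    MDiff (seqSlash w m g h j) :=
  sum_induction _ _ (fun _ _ => MDifferentiable.add) mdifferentiable_const fun p _ =>
    (((gaussCoeff_mdifferentiable m g).pow p.1).mul ((hh p.2).slash _ g)).const_smul _

theorem heatIter_seqSlash (hg : 0 < g.det.val) (hh : ∀ j, MDiff (h j)) (ν : ℕ) :
    heatIter w (m * g.det.val) ν (seqSlash w m g h) =
      seqSlash (w + 2 * ν) m g (heatIter w m ν h) := by
  induction ν generalizing w h with
  | zero => simp [heatIter]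
  | succ ν ih =>
    rw [heatIter, heat_seqSlash hg hh, ih (heat_mdifferentiable hh), heatIter]
    push_cast
    ring_nf

theorem seqSlash_apply_zero (w : ℤ) (m : ℂ) (g : GL (Fin 2) ℝ) (h : ℕ → ℍ → ℂ) :
    seqSlash w m g h 0 = h 0 ∣[w] g := by
  simp [seqSlash]

end Equivariance

section TaylorSeq

open Finset

/-- The coefficients of `f` in powers of `2πi z`, which are the values at `0` of the normalized
derivatives `(∂_z / 2πi)^n / n!`. -/
def taylorSeq (f : ℂ → ℂ) (n : ℕ) : ℂ :=
  (2 * Real.pi * Complex.I)⁻¹ ^ n * (n.factorial : ℂ)⁻¹ * iteratedDeriv n f 0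

theorem taylorSeq_const_mul (c : ℂ) (f : ℂ → ℂ) (n : ℕ) :
    taylorSeq (fun z => c * f z) n = c * taylorSeq f n := by
  rw [taylorSeq, taylorSeq, iteratedDeriv_const_mul_field]
  ring

theorem taylorSeq_sum {ι : Type*} {s : Finset ι} {f : ι → ℂ → ℂ}
    (hf : ∀ i ∈ s, Differentiable ℂ (f i)) (n : ℕ) :
    taylorSeq (fun z => ∑ i ∈ s, f i z) n = ∑ i ∈ s, taylorSeq (f i) n := by
  simp only [taylorSeq, iteratedDeriv_fun_sum fun i hi => (hf i hi).contDiff.contDiffAt, mul_sum]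

theorem taylorSeq_comp_const_mul {f : ℂ → ℂ} (hf : Differentiable ℂ f) (c : ℂ) (n : ℕ) :
    taylorSeq (fun z => f (c * z)) n = c ^ n * taylorSeq f n := by
  simp only [taylorSeq, iteratedDeriv_comp_const_mul hf.contDiff, mul_zero]
  ring

theorem taylorSeq_mul {f g : ℂ → ℂ} (hf : Differentiable ℂ f) (hg : Differentiable ℂ g) (n : ℕ) :
    taylorSeq (fun z => f z * g z) n =
      ∑ p ∈ antidiagonal n, taylorSeq f p.1 * taylorSeq g p.2 := by
  rw [taylorSeq, iteratedDeriv_fun_mul hf.contDiff.contDiffAt hg.contDiff.contDiffAt,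
    Nat.sum_antidiagonal_eq_sum_range_succ fun i j => taylorSeq f i * taylorSeq g j, mul_sum]
  refine sum_congr rfl fun i hi => ?_
  have hin : i ≤ n := Nat.lt_succ_iff.1 (mem_range.1 hi)
  have hn : (n.factorial : ℂ) ≠ 0 := Nat.cast_ne_zero.2 n.factorial_ne_zero
  rw [taylorSeq, taylorSeq, Nat.cast_choose ℂ hin, ← pow_mul_pow_sub _ hin]
  field_simp

theorem iteratedDeriv_gaussian_add_two (a : ℂ) (n : ℕ) :
    iteratedDeriv (n + 2) (fun z => e (a * z ^ 2)) 0 =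
      2 * (2 * Real.pi * Complex.I * a) * (n + 1) * iteratedDeriv n (fun z => e (a * z ^ 2)) 0 := by
  have hE : ContDiff ℂ ⊤ fun z => e (a * z ^ 2) := by unfold e; fun_prop
  have hderiv : deriv (fun z => e (a * z ^ 2)) =
      fun z => 2 * (2 * Real.pi * Complex.I * a) * (z * e (a * z ^ 2)) := by
    ext z
    refine ((((hasDerivAt_id z).pow 2).const_mul a).const_mul _).cexp.deriv.trans ?_
    simp [e]
    ring
  rw [iteratedDeriv_succ', hderiv, iteratedDeriv_const_mul_field,
    iteratedDeriv_fun_mul contDiffAt_fun_id (hE.of_le le_top).contDiffAt,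
    sum_eq_single_of_mem 1 (by simp) fun i _ hi => by simp [iteratedDeriv_fun_id_zero, hi]]
  simp [iteratedDeriv_fun_id_zero]
  ring

theorem taylorSeq_gaussian_add_two (a : ℂ) (n : ℕ) :
    (n + 2) * taylorSeq (fun z => e (a * z ^ 2)) (n + 2) =
      2 * ((2 * Real.pi * Complex.I)⁻¹ * a) * taylorSeq (fun z => e (a * z ^ 2)) n := by
  have hn : (n + 1 : ℂ) ≠ 0 := Nat.cast_add_one_ne_zero n
  have hn' : (n + 2 : ℂ) ≠ 0 := by exact_mod_cast (n + 1).succ_ne_zero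
  rw [taylorSeq, taylorSeq, iteratedDeriv_gaussian_add_two, Nat.factorial_succ (n + 1),
    Nat.factorial_succ n]
  push_cast
  rw [show (n : ℂ) + 1 + 1 = n + 2 by ring]
  have hc := Complex.two_pi_I_ne_zero
  generalize (2 * Real.pi * Complex.I : ℂ) = c at hc ⊢
  rw [inv_pow, inv_pow, pow_add]
  field_simp

theorem taylorSeq_gaussian_even (a : ℂ) (i : ℕ) :
    taylorSeq (fun z => e (a * z ^ 2)) (2 * i) =
      (i.factorial : ℂ)⁻¹ * ((2 * Real.pi * Complex.I)⁻¹ * a) ^ i := by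
  induction i with
  | zero => simp [taylorSeq, e]
  | succ i ih =>
    have h := taylorSeq_gaussian_add_two a (2 * i)
    have hi : (i + 1 : ℂ) ≠ 0 := Nat.cast_add_one_ne_zero i
    rw [ih] at h
    rw [← mul_right_inj' (mul_ne_zero two_ne_zero hi), Nat.factorial_succ]
    push_cast at h ⊢
    rw [mul_add_one 2 (i : ℂ), mul_add_one 2 i, h, pow_succ]
    field_simp

theorem taylorSeq_gaussian_odd (a : ℂ) (i : ℕ) :
    taylorSeq (fun z => e (a * z ^ 2)) (2 * i + 1) = 0 := by
  induction i with
  | zero =>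
    have h := ((((hasDerivAt_id (0 : ℂ)).pow 2).const_mul a).const_mul
      (2 * Real.pi * Complex.I)).cexp.deriv
    simp_all [taylorSeq, e]
  | succ i ih =>
    have h := taylorSeq_gaussian_add_two a (2 * i + 1)
    rw [ih, mul_zero] at h
    exact (mul_eq_zero.1 h).resolve_left (by exact_mod_cast (2 * i + 2).succ_ne_zero)

theorem sum_antidiagonal_two_mul_add {V : Type*} [AddCommMonoid V] {f : ℕ × ℕ → V}
    (hf : ∀ i j, f (2 * i + 1, j) = 0) (j : ℕ) {v : ℕ} (hv : v < 2) :
    ∑ p ∈ antidiagonal (2 * j + v), f p =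
      ∑ p ∈ antidiagonal j, f (2 * p.1, 2 * p.2 + v) := by
  symm
  refine sum_of_injOn (fun p => (2 * p.1, 2 * p.2 + v)) ?_ ?_ ?_ fun _ _ => rfl
  · rintro ⟨a, b⟩ _ ⟨c, d⟩ _ h
    simp only [Prod.mk.injEq] at h ⊢
    lia
  · rintro ⟨a, b⟩ h
    simp only [SetLike.mem_coe, HasAntidiagonal.mem_antidiagonal] at h ⊢
    lia
  · rintro ⟨a, b⟩ h h'
    obtain ⟨i, rfl | rfl⟩ := Nat.even_or_odd' a
    · refine absurd ⟨(i, j - i), ?_⟩ h'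
      simp only [SetLike.mem_coe, HasAntidiagonal.mem_antidiagonal, Prod.mk.injEq] at h ⊢
      lia
    · exact hf i b

theorem taylorSeq_gaussian_mul {f : ℂ → ℂ} (hf : Differentiable ℂ f) (a : ℂ) (j : ℕ) {v : ℕ}
    (hv : v < 2) :
    taylorSeq (fun z => e (a * z ^ 2) * f z) (2 * j + v) =
      ∑ p ∈ antidiagonal j, (p.1.factorial : ℂ)⁻¹ * ((2 * Real.pi * Complex.I)⁻¹ * a) ^ p.1 *
        taylorSeq f (2 * p.2 + v) := by
  have hE : Differentiable ℂ fun z => e (a * z ^ 2) := by unfold e; fun_prop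
  rw [taylorSeq_mul hE hf, sum_antidiagonal_two_mul_add
    (fun i j => by rw [taylorSeq_gaussian_odd, zero_mul]) j hv]
  simp only [taylorSeq_gaussian_even]

end TaylorSeq

section SlashRealGL

variable {M : Matrix (Fin 2) (Fin 2) ℤ}

theorem slash_realGL_apply (hM : 0 < M.det) (κ : ℤ) (f : ℍ → ℂ) (τ : ℍ) :
    (f ∣[κ] realGL M hM) τ =
      (M.det : ℂ) ^ (κ - 1) * (autFactor M τ ^ (-κ) * f (moebius M τ)) := by
  have hdet : (|(realGL M hM).det.val| : ℝ) = M.det := by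
    rw [abs_of_pos (det_realGL_pos hM), det_realGL]
  rw [ModularForm.slash_apply, σ, if_pos (det_realGL_pos hM), hdet, denom_realGL,
    moebius_eq_smul hM]
  simp only [ContinuousAlgEquiv.refl_apply, Complex.ofReal_intCast]
  ring

theorem gaussCoeff_realGL (hM : 0 < M.det) (m : ℂ) (τ : ℍ) :
    gaussCoeff m (realGL M hM) τ =
      (2 * Real.pi * Complex.I)⁻¹ * (-(M 1 0) * (M.det * m) / autFactor M τ) := by
  rw [gaussCoeff, det_realGL, denom_realGL]
  simp [realGL, Matrix.GeneralLinearGroup.mkOfDetNeZero]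
  ring

end SlashRealGL

section TaylorCoeff

open Derivative Finset
open scoped Manifold

variable {k : ℤ} {L : Matrix (Fin 1) (Fin 1) ℤ} {φ : ℍ → (Fin 1 → ℂ) → ℂ}

/-- The coefficient of `(2πi z)^n` in `φ (τ, z)`, as a function of `τ`. -/
def taylorCoeff (φ : ℍ → (Fin 1 → ℂ) → ℂ) (n : ℕ) (τ : ℍ) : ℂ :=
  taylorSeq (fun z => φ τ fun _ => z) n

theorem IsHolo.sepHolo (hφ : IsHolo φ) :
    SepHolo upperHalfPlaneSet Set.univ fun t z => φ (ofComplex t) fun _ => z :=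
  sepHolo_of_differentiableOn isOpen_upperHalfPlaneSet isOpen_univ <|
    hφ.comp (f := fun p : ℂ × ℂ => (p.1, fun _ : Fin 1 => p.2)) (by fun_prop) fun _ hp => hp.1

theorem IsHolo.differentiable (hφ : IsHolo φ) (τ : ℍ) :
    Differentiable ℂ fun z => φ τ fun _ => z := by
  have h := hφ.sepHolo.right τ τ.im_pos
  rwa [ofComplex_apply, differentiableOn_univ] at h

theorem IsHolo.mdifferentiable_taylorCoeff (hφ : IsHolo φ) (n : ℕ) : MDiff (taylorCoeff φ n) :=
  UpperHalfPlane.mdifferentiable_iff.2 <| DifferentiableOn.const_mul (fun _ ht =>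
    (hφ.sepHolo.hasDerivAt_iteratedDeriv isOpen_upperHalfPlaneSet isOpen_univ n ht
      (Set.mem_univ 0)).differentiableAt.differentiableWithinAt) _

theorem iterate_normalizedDeriv_apply (f : ℍ → ℂ) (b : ℕ) (τ : ℍ) :
    (D^[b] f) τ = (2 * Real.pi * Complex.I)⁻¹ ^ b * iteratedDeriv b (f ∘ ofComplex) τ := by
  induction b generalizing τ with
  | zero => simp
  | succ b ih =>
    have hev : (D^[b] f) ∘ ofComplex =ᶠ[nhds (τ : ℂ)]
        fun t => (2 * Real.pi * Complex.I)⁻¹ ^ b * iteratedDeriv b (f ∘ ofComplex) t := by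
      filter_upwards [isOpen_upperHalfPlaneSet.mem_nhds τ.im_pos] with t ht
      rw [Function.comp_apply, ih, coe_ofComplex ht]
    rw [Function.iterate_succ_apply', normalizedDerivOfComplex, hev.deriv_eq,
      deriv_const_mul_field, iteratedDeriv_succ, pow_succ']
    ring

theorem taylorDeriv_eq_smul_iterate (hφ : IsHolo φ) (a b : ℕ) :
    taylorDeriv a b φ = (a.factorial : ℂ) • D^[b] (taylorCoeff φ a) := by
  ext τ
  have ha : (a.factorial : ℂ) ≠ 0 := Nat.cast_ne_zero.2 a.factorial_ne_zero
  have hcomp : taylorCoeff φ a ∘ ofComplex = fun t =>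
      ((2 * Real.pi * Complex.I)⁻¹ ^ a * (a.factorial : ℂ)⁻¹) *
        iteratedDeriv a (fun z => φ (ofComplex t) fun _ => z) 0 := rfl
  rw [taylorDeriv, Pi.smul_apply, iterate_normalizedDeriv_apply, hcomp,
    iteratedDeriv_const_mul_field, hφ.sepHolo.iteratedDeriv_comm isOpen_upperHalfPlaneSet
      isOpen_univ a b τ.im_pos (Set.mem_univ 0), smul_eq_mul, pow_add]
  field_simp

theorem zpow_neg_mul_div_pow {J d : ℂ} (hJ : J ≠ 0) (hd : d ≠ 0) (k : ℤ) (n : ℕ) :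
    J ^ (-k) * (d / J) ^ n = d ^ (1 - k) * (d ^ (k + n - 1) * J ^ (-(k + n))) := by
  rw [← mul_assoc, ← zpow_add₀ hd, show 1 - k + (k + n - 1) = (n : ℤ) by ring, neg_add,
    zpow_add₀ hJ, zpow_neg J n, zpow_natCast, zpow_natCast, div_pow]
  ring

theorem taylorCoeff_slashMat (hφ : IsHolo φ) {M : Matrix (Fin 2) (Fin 2) ℤ}
    (hM : 0 < M.det) {v : ℕ} (hv : v < 2) :
    (fun j => taylorCoeff (slashMat k L M φ) (2 * j + v)) =
      (M.det : ℂ) ^ (1 - k) •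
        seqSlash (k + v) (L 0 0 / 2) (realGL M hM) fun j => taylorCoeff φ (2 * j + v) := by
  ext j τ
  have hJ := autFactor_ne_zero hM τ
  have hdet : (M.det : ℂ) ≠ 0 := by exact_mod_cast hM.ne'
  have hd := hφ.differentiable (moebius M τ)
  set c : ℂ := -(M 1 0) * (M.det * L 0 0) / (2 * autFactor M τ) with hc
  set B : ℂ := M.det / autFactor M τ
  have hslice : (fun z => slashMat k L M φ τ fun _ => z) = fun z =>
      autFactor M τ ^ (-k) * (e (c * z ^ 2) * φ (moebius M τ) fun _ => B * z) := by
    ext z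
    rw [slashMat_apply, mul_assoc]
    congr 3
    simp [quad, bil, mulVec, dotProduct, hc]
    ring
  rw [taylorCoeff, hslice, taylorSeq_const_mul,
    taylorSeq_gaussian_mul (f := fun z => φ (moebius M τ) fun _ => B * z)
      (hd.comp (differentiable_id.const_mul B)) c j hv]
  simp only [Pi.smul_apply, seqSlash, Finset.sum_apply, Pi.mul_apply, Pi.pow_apply, smul_eq_mul,
    slash_realGL_apply, gaussCoeff_realGL, mul_sum]
  refine sum_congr rfl fun p _ => ?_
  have hκ : k + v + 2 * (p.2 : ℤ) = k + (2 * p.2 + v : ℕ) := by push_cast; ring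
  have hpow := zpow_neg_mul_div_pow hJ hdet k (2 * p.2 + v)
  rw [taylorSeq_comp_const_mul hd, taylorCoeff, hκ,
    show (-(M 1 0) * (M.det * (L 0 0 / 2)) / autFactor M τ : ℂ) = c by rw [hc]; ring]
  linear_combination (p.1.factorial : ℂ)⁻¹ * ((2 * Real.pi * Complex.I)⁻¹ * c) ^ p.1 *
    taylorSeq (fun z => φ (moebius M τ) fun _ => z) (2 * p.2 + v) * hpow

theorem taylorCoeff_heckeV (hφ : IsHolo φ) {l : ℕ} [NeZero l] {v : ℕ} (hv : v < 2) :
    (fun j => taylorCoeff (heckeV k L l φ) (2 * j + v)) =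
      ∑ q : HeckeCosets l, seqSlash (k + v) (L 0 0 / 2)
        (realGL (Quotient.out q).1 (det_pos_of_fixedDet _)) fun j => taylorCoeff φ (2 * j + v) := by
  have hl : (l : ℂ) ≠ 0 := Nat.cast_ne_zero.2 (NeZero.ne l)
  have hcoeff : (fun j => taylorCoeff (heckeV k L l φ) (2 * j + v)) = (l : ℂ) ^ (k - 1) •
      ∑ q : HeckeCosets l, fun j =>
        taylorCoeff (slashMat k L (Quotient.out q).1 φ) (2 * j + v) := by
    ext j τ
    have hterm (q : HeckeCosets l) :=
      (hφ.slashMat (k := k) (L := L) (det_pos_of_fixedDet (Quotient.out q))).differentiable τ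
    simp only [taylorCoeff, heckeV_eq_sum, Pi.smul_apply, Finset.sum_apply, smul_eq_mul]
    rw [taylorSeq_const_mul, taylorSeq_sum fun q _ => hterm q]
  rw [hcoeff, smul_sum]
  refine sum_congr rfl fun q _ => ?_
  rw [taylorCoeff_slashMat hφ (det_pos_of_fixedDet _) hv, (Quotient.out q).2, smul_smul,
    Int.cast_natCast, ← zpow_add₀ hl, show k - 1 + (1 - k) = 0 by ring, zpow_zero, one_smul]

theorem IsJacobiForm.cuspBdd (hφ : IsJacobiForm k L φ) :
    CuspBdd fun t z => φ (ofComplex t) fun _ => z := by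
  obtain ⟨hholo, hmod, -, hbdd⟩ := isJacobiForm_iff.1 hφ
  refine ⟨hholo.sepHolo, fun t z ht => ?_, fun y => ?_⟩
  · have h := congrFun (congrFun (hmod ModularGroup.T) (ofComplex t)) fun _ => z
    have hT : ModularGroup.T.1 = !![1, 1; 0, 1] := rfl
    simpa [slashMat_apply, hT, autFactor, moebius, coe_ofComplex ht, e_zero, Pi.smul_def] using h
  · have h := hbdd 0 fun _ => y
    have h0 : (fun _ => 0 : Fin 1 → ℂ) = 0 := rfl
    simpa [heisSlash_apply, e_zero, quad, bil, h0] using h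

theorem IsJacobiForm.taylorCoeff_mem_holoBdd (hφ : IsJacobiForm k L φ) (n : ℕ) :
    taylorCoeff φ n ∈ holoBdd := by
  refine ⟨(isJacobiForm_iff.1 hφ).1.mdifferentiable_taylorCoeff n, ?_⟩
  have h := hφ.cuspBdd.isBoundedAtImInfty_iteratedDeriv n 0
  rw [Rat.cast_zero] at h
  exact (h.const_mul_left _).congr_left fun τ => by rw [ofComplex_apply]; rfl

end TaylorCoeff

section HeckeOnModularForms

open Finset
open scoped Manifold

variable {κ : ℤ} {l : ℕ} {f : ℍ → ℂ}

theorem slash_realGL_coe (κ : ℤ) (f : ℍ → ℂ) (γ : SL(2, ℤ)) (hγ : 0 < γ.1.det) :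
    f ∣[κ] realGL γ.1 hγ = f ∣[κ] γ := by
  rw [ModularForm.SL_slash]
  congr 1
  ext i j
  simp [realGL, Matrix.GeneralLinearGroup.mkOfDetNeZero]

theorem exists_modularForm (hf : f ∈ holoBdd) (hinv : ∀ γ : SL(2, ℤ), f ∣[κ] γ = f) :
    ∃ g : ModularForm 𝒮ℒ κ, ⇑g = f := by
  refine ⟨⟨⟨f, ?_⟩, hf.1, fun hc => ?_⟩, rfl⟩
  · rintro _ ⟨γ, rfl⟩
    exact hinv γ
  · rw [OnePoint.isBoundedAt_iff_forall_SL2Z hc]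
    intro γ _
    exact (hinv γ).symm ▸ hf.2

theorem modularForm_mem_holoBdd (f : ModularForm 𝒮ℒ κ) : ⇑f ∈ holoBdd :=
  ⟨ModularFormClass.holo f,
    OnePoint.isBoundedAt_infty_iff.1 (ModularFormClass.bdd_at_cusps f Fact.out)⟩

theorem modularForm_slash_eq (f : ModularForm 𝒮ℒ κ) (γ : SL(2, ℤ)) : ⇑f ∣[κ] γ = f :=
  SlashInvariantForm.slash_action_eqn f _ (MonoidHom.mem_range.2 ⟨γ, rfl⟩)

variable [NeZero l]

/-- The slash action on `f` of an integral matrix of determinant `l`; in contrast to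
`heckeTTerm`, it includes the factor `l^(κ-1)`. -/
def slashFixedDet (κ : ℤ) (f : ℍ → ℂ) (M : FixedDetMatrix (Fin 2) ℤ (l : ℤ)) : ℍ → ℂ :=
  f ∣[κ] realGL M.1 (det_pos_of_fixedDet M)

theorem slashFixedDet_eq_smul_heckeTTerm (κ : ℤ) (f : ℍ → ℂ)
    (M : FixedDetMatrix (Fin 2) ℤ (l : ℤ)) :
    slashFixedDet κ f M = (l : ℂ) ^ (κ - 1) • heckeTTerm κ l f M := by
  ext τ
  rw [slashFixedDet, slash_realGL_apply, M.2, Int.cast_natCast]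
  rfl

theorem heckeT_eq_sum (κ : ℤ) (f : ℍ → ℂ) :
    heckeT κ l f = ∑ q : HeckeCosets l, slashFixedDet κ f (Quotient.out q) := by
  ext τ
  simp only [heckeT, finsum_eq_sum_of_fintype, Finset.sum_apply, slashFixedDet_eq_smul_heckeTTerm,
    Pi.smul_apply, smul_eq_mul, mul_sum]

theorem slashFixedDet_smul (hf : ∀ γ : SL(2, ℤ), f ∣[κ] γ = f) (γ : SL(2, ℤ))
    (M : FixedDetMatrix (Fin 2) ℤ (l : ℤ)) : slashFixedDet κ f (γ • M) = slashFixedDet κ f M := by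
  simp only [slashFixedDet, FixedDetMatrices.smul_coe]
  rw [realGL_mul (det_pos_of_SL γ) (det_pos_of_fixedDet M), SlashAction.slash_mul,
    slash_realGL_coe, hf]

theorem slashFixedDet_mulRight (κ : ℤ) (f : ℍ → ℂ) (γ : SL(2, ℤ))
    (M : FixedDetMatrix (Fin 2) ℤ (l : ℤ)) :
    slashFixedDet κ f (mulRight γ M) = slashFixedDet κ f M ∣[κ] γ := by
  simp only [slashFixedDet, coe_mulRight]
  rw [realGL_mul (det_pos_of_fixedDet M) (det_pos_of_SL γ), SlashAction.slash_mul,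
    slash_realGL_coe]

theorem heckeTTerm_smul (hf : ∀ γ : SL(2, ℤ), f ∣[κ] γ = f) (γ : SL(2, ℤ))
    (M : FixedDetMatrix (Fin 2) ℤ (l : ℤ)) : heckeTTerm κ l f (γ • M) = heckeTTerm κ l f M := by
  have hl : (l : ℂ) ^ (κ - 1) ≠ 0 := zpow_ne_zero _ (Nat.cast_ne_zero.2 (NeZero.ne l))
  have h := slashFixedDet_smul hf γ M
  rw [slashFixedDet_eq_smul_heckeTTerm, slashFixedDet_eq_smul_heckeTTerm] at h
  exact smul_right_injective _ hl h

theorem slashFixedDet_mem_holoBdd (hf : f ∈ holoBdd) (hinv : ∀ γ : SL(2, ℤ), f ∣[κ] γ = f)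
    (M : FixedDetMatrix (Fin 2) ℤ (l : ℤ)) : slashFixedDet κ f M ∈ holoBdd := by
  obtain ⟨γ, hγ⟩ := exists_smul_upperTriangular M
  rw [← slashFixedDet_smul hinv γ]
  refine ⟨hf.1.slash κ _, IsBoundedAtImInfty.slash κ ?_ hf.2⟩
  simp [realGL, Matrix.GeneralLinearGroup.mkOfDetNeZero, hγ]

theorem exists_modularForm_heckeT (l : ℕ) [NeZero l] (f : ModularForm 𝒮ℒ κ) :
    ∃ g : ModularForm 𝒮ℒ κ, ⇑g = heckeT κ l f := by
  rw [heckeT_eq_sum]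
  refine exists_modularForm (sum_mem fun q _ => slashFixedDet_mem_holoBdd
    (modularForm_mem_holoBdd f) (modularForm_slash_eq f) _) fun γ => ?_
  rw [SlashAction.sum_slash]
  simp only [← slashFixedDet_mulRight]
  exact sum_mulRight_out (slashFixedDet_smul (modularForm_slash_eq f)) γ

end HeckeOnModularForms

section HeatTaylor

open Derivative Finset
open scoped Manifold

variable {k : ℤ} {L : Matrix (Fin 1) (Fin 1) ℤ} {φ : ℍ → (Fin 1 → ℂ) → ℂ}

/-- The operators `𝒟_{2ν}` (for `v = 0`) and `𝒟_{2ν+1}` (for `v = 1`) of weight `k` and scalar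
index `m`, as normalised iterated heat operators on the Taylor coefficients. -/
def heatTaylor (k : ℤ) (m : ℂ) (v ν : ℕ) (φ : ℍ → (Fin 1 → ℂ) → ℂ) : ℍ → ℂ :=
  ((-1) ^ ν * (2 * ν + v).factorial / ν.factorial : ℂ) •
    heatIter (k + v) m ν (fun j => taylorCoeff φ (2 * j + v)) 0

theorem heatTaylor_eq_sum (hφ : IsHolo φ) (m : ℂ) (v ν : ℕ) (τ : ℍ) :
    heatTaylor k m v ν φ τ = ∑ μ ∈ range (ν + 1),
      (-1) ^ μ * ((2 * ν + v).factorial : ℂ) * factorialQuotient (k + v + ν - 2) (ν - μ) /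
          ((μ.factorial : ℂ) * ((2 * ν + v - 2 * μ).factorial : ℂ)) *
        m ^ μ * taylorDeriv (2 * ν + v - 2 * μ) μ φ τ := by
  rw [heatTaylor, heatIter_zero_eq_sum fun j => hφ.mdifferentiable_taylorCoeff _,
    Nat.sum_antidiagonal_eq_sum_range_succ_mk, smul_sum, Finset.sum_apply]
  refine sum_congr rfl fun μ hμ => ?_
  obtain ⟨q, rfl⟩ := Nat.exists_eq_add_of_le (mem_range_succ_iff.1 hμ)
  have hμ0 : (μ.factorial : ℂ) ≠ 0 := Nat.cast_ne_zero.2 μ.factorial_ne_zero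
  have hν0 : ((μ + q).factorial : ℂ) ≠ 0 := Nat.cast_ne_zero.2 (μ + q).factorial_ne_zero
  have hq0 : ((2 * q + v).factorial : ℂ) ≠ 0 := Nat.cast_ne_zero.2 (2 * q + v).factorial_ne_zero
  have hsign : (-1 : ℂ) ^ q * (-1) ^ q = 1 := by rw [← mul_pow]; simp
  rw [show 2 * (μ + q) + v - 2 * μ = 2 * q + v by omega, Nat.add_sub_cancel_left,
    taylorDeriv_eq_smul_iterate hφ]
  simp only [Pi.smul_apply, smul_eq_mul]
  rw [pow_add]
  field_simp
  linear_combination ((2 * (μ + q) + v).factorial : ℂ) * m ^ μ *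
    factorialQuotient (k + v + (μ + q : ℕ) - 2) q * (D^[μ] (taylorCoeff φ (2 * q + v))) τ * hsign

theorem taylorEven_eq_heatTaylor (hφ : IsHolo φ) (m : ℂ) (ν : ℕ) :
    taylorEven k m ν φ = heatTaylor k m 0 ν φ := by
  ext τ
  simp only [heatTaylor_eq_sum hφ, taylorEven, Nat.cast_zero, add_zero]

theorem taylorOdd_eq_heatTaylor (hφ : IsHolo φ) (m : ℂ) (ν : ℕ) :
    taylorOdd k m ν φ = heatTaylor k m 1 ν φ := by
  ext τ
  rw [heatTaylor_eq_sum hφ, taylorOdd, show k + (1 : ℕ) + ν - 2 = k + ν - 1 by push_cast; ring]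

theorem taylorOp_eq_heatTaylor (hφ : IsHolo φ) (n : ℕ) :
    taylorOp k L n φ =
      if Even k ↔ Even n then heatTaylor k (L 0 0 / 2) (n % 2) (n / 2) φ else 0 := by
  rw [taylorOp, taylorEven_eq_heatTaylor hφ, taylorOdd_eq_heatTaylor hφ]
  rcases Nat.even_or_odd n with hn | hn
  · simp [hn, Nat.even_iff.1 hn, Nat.not_odd_iff_even.2 hn]
  · simp [hn, Nat.odd_iff.1 hn, Nat.not_even_iff_odd.2 hn]

theorem heatTaylor_slash (hφ : IsHolo φ) {γ : SL(2, ℤ)} (hγ : slashMat k L γ.1 φ = φ)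
    {v : ℕ} (hv : v < 2) (ν : ℕ) :
    heatTaylor k (L 0 0 / 2) v ν φ ∣[k + v + 2 * ν] γ = heatTaylor k (L 0 0 / 2) v ν φ := by
  have hdet := det_pos_of_SL γ
  have hh j : MDiff (taylorCoeff φ (2 * j + v)) := hφ.mdifferentiable_taylorCoeff _
  have hseq := taylorCoeff_slashMat (k := k) (L := L) hφ hdet hv
  rw [hγ, γ.2, Int.cast_one, _root_.one_zpow, one_smul] at hseq
  have hheat := heatIter_seqSlash (w := k + v) (m := L 0 0 / 2) (det_realGL_pos hdet) hh ν
  rw [det_realGL, γ.2, Int.cast_one, Complex.ofReal_one, mul_one, ← hseq] at hheat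
  rw [← slash_realGL_coe _ _ γ hdet, heatTaylor, smul_slash_of_det_pos (det_realGL_pos hdet),
    ← seqSlash_apply_zero _ (L 0 0 / 2), ← hheat]

theorem heatTaylor_heckeV (hφ : IsHolo φ) {l : ℕ} [NeZero l] {v : ℕ} (hv : v < 2) (ν : ℕ) :
    heatTaylor k (L 0 0 / 2 * l) v ν (heckeV k L l φ) =
      heckeT (k + v + 2 * ν) l (heatTaylor k (L 0 0 / 2) v ν φ) := by
  let h (j : ℕ) : ℍ → ℂ := taylorCoeff φ (2 * j + v)
  have hh j : MDiff (h j) := hφ.mdifferentiable_taylorCoeff _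
  have hterm (q : HeckeCosets l) :
      heatIter (k + v) (L 0 0 / 2 * l) ν (seqSlash (k + v) (L 0 0 / 2)
        (realGL (Quotient.out q).1 (det_pos_of_fixedDet _)) h) 0 =
      slashFixedDet (k + v + 2 * ν) (heatIter (k + v) (L 0 0 / 2) ν h 0) (Quotient.out q) := by
    have hq := det_realGL_pos (det_pos_of_fixedDet (Quotient.out q))
    have hdet := det_realGL (det_pos_of_fixedDet (Quotient.out q))
    rw [(Quotient.out q).2, Int.cast_natCast] at hdet
    rw [slashFixedDet, ← seqSlash_apply_zero _ (L 0 0 / 2), ← heatIter_seqSlash hq hh, hdet,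
      Complex.ofReal_natCast]
  rw [heatTaylor, taylorCoeff_heckeV hφ hv, heatIter_sum fun q _ j => seqSlash_mdifferentiable hh j,
    heckeT_eq_sum, Finset.sum_apply, smul_sum]
  refine sum_congr rfl fun q _ => ?_
  rw [slashFixedDet, heatTaylor, smul_slash_of_det_pos (det_realGL_pos _)]
  exact congrArg _ (hterm q)

theorem add_mod_two_add_two_mul_div_two (k : ℤ) (n : ℕ) :
    k + (n % 2 : ℕ) + 2 * (n / 2 : ℕ) = k + n := by
  omega

theorem IsJacobiForm.exists_taylorOp (hφ : IsJacobiForm k L φ) (n : ℕ) :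
    ∃ f : ModularForm 𝒮ℒ (k + n), ⇑f = taylorOp k L n φ := by
  have hholo := (isJacobiForm_iff.1 hφ).1
  rw [taylorOp_eq_heatTaylor hholo]
  split_ifs
  · rw [← add_mod_two_add_two_mul_div_two]
    exact exists_modularForm
      (holoBdd.smul_mem _ (heatIter_mem_holoBdd (fun j => hφ.taylorCoeff_mem_holoBdd _) _ _))
      fun γ => heatTaylor_slash hholo (hφ.slashMat_eq γ) (Nat.mod_lt n two_pos) _
  · exact ⟨0, rfl⟩

theorem taylorOp_heckeV (hφ : IsHolo φ) {l : ℕ} [NeZero l] (n : ℕ) :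
    taylorOp k ((l : ℤ) • L) n (heckeV k L l φ) = heckeT (k + n) l (taylorOp k L n φ) := by
  have hindex : (((l : ℤ) • L) 0 0 : ℂ) / 2 = L 0 0 / 2 * l := by
    rw [Matrix.smul_apply, smul_eq_mul]
    push_cast
    ring
  rw [taylorOp_eq_heatTaylor hφ, taylorOp_eq_heatTaylor hφ.heckeV, hindex]
  split_ifs
  · rw [heatTaylor_heckeV hφ (Nat.mod_lt n two_pos), add_mod_two_add_two_mul_div_two]
  · simp [heckeT_eq_sum, slashFixedDet, SlashAction.zero_slash]

end HeatTaylor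

end JacobiHecke

end

open JacobiHecke in
theorem mainTheorem7 {N : ℕ} (k : ℤ) (L : Matrix (Fin N) (Fin N) ℤ) (hL : IsJacobiIndex L)
    (l : ℕ) (hl : 0 < l) :
    -- the summands of `V_l` and of `T_l` only depend on the cosets
    (∀ φ : ℍ → (Fin N → ℂ) → ℂ, (∀ γ : SL(2, ℤ), jacobiSlash k L γ 0 0 φ = φ) →
      ∀ (γ : SL(2, ℤ)) (M : FixedDetMatrix (Fin 2) ℤ (l : ℤ)),
        heckeVTerm k L l φ (γ • M) = heckeVTerm k L l φ M) ∧
    (∀ (κ : ℤ) (f : ModularForm 𝒮ℒ κ) (γ : SL(2, ℤ)) (M : FixedDetMatrix (Fin 2) ℤ (l : ℤ)),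
        heckeTTerm κ l f (γ • M) = heckeTTerm κ l f M) ∧
    -- restriction commutes with `V_l`
    (∀ (N' : ℕ) (s : Matrix (Fin N) (Fin N') ℤ) (φ : ℍ → (Fin N → ℂ) → ℂ),
      heckeV k (indexPullback L s) l (restrict s φ) = restrict s (heckeV k L l φ)) ∧
    (∀ (N' : ℕ) (s : Matrix (Fin N) (Fin N') ℤ) (φ : ℍ → (Fin N → ℂ) → ℂ), IsJacobiForm k L φ →
      IsJacobiForm k (indexPullback L s) (restrict s φ)) ∧
    -- the horizontal arrows of the diagram
    (∀ φ : ℍ → (Fin N → ℂ) → ℂ, IsJacobiForm k L φ →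
      IsJacobiForm k ((l : ℤ) • L) (heckeV k L l φ)) ∧
    (∀ (κ : ℤ) (f : ModularForm 𝒮ℒ κ), ∃ g : ModularForm 𝒮ℒ κ, ⇑g = heckeT κ l f) ∧
    -- the vertical arrows of the diagram, and its commutativity
    (∀ (s : Matrix (Fin N) (Fin 1) ℤ) (n : ℕ) (φ : ℍ → (Fin N → ℂ) → ℂ), IsJacobiForm k L φ →
      ∃ f g : ModularForm 𝒮ℒ (k + n),
        ⇑f = taylorOp k (indexPullback L s) n (restrict s φ) ∧
        ⇑g = taylorOp k (indexPullback ((l : ℤ) • L) s) n (restrict s (heckeV k L l φ)) ∧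
        ⇑g = heckeT (k + n) l f) := by
  have : NeZero l := ⟨hl.ne'⟩
  refine ⟨fun φ hφ γ M => ?_, fun κ f => heckeTTerm_smul (modularForm_slash_eq f),
    fun N' s φ => heckeV_restrict l s φ, fun N' s φ hφ => hφ.restrict s,
    fun φ hφ => hφ.heckeV hL, fun κ f => exists_modularForm_heckeT l f, fun s n φ hφ => ?_⟩
  · rw [heckeVTerm_eq_slashMat, heckeVTerm_eq_slashMat]
    exact slashMat_smul_of_invariant (fun γ => by rw [← jacobiSlash_zero_eq_slashMat, hφ]) γ M
  · obtain ⟨f, hf⟩ := (hφ.restrict s).exists_taylorOp n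
    obtain ⟨g, hg⟩ := ((hφ.heckeV (l := l) hL).restrict s).exists_taylorOp n
    refine ⟨f, g, hf, hg, ?_⟩
    rw [hg, hf, ← heckeV_restrict, indexPullback_zsmul]
    exact taylorOp_heckeV (isJacobiForm_iff.1 (hφ.restrict s)).1 n
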